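/- Let $H$ be a complex Hilbert space and let $E$ be a linear operator in $H$, defined on a linear subspace $\operatorname{dom}(E)\subseteq H$ ($E$ is not assumed to be closed or densely defined). Let $\rho(E)$ be the set of $\lambda\in\mathbb C$ such that $\lambda-E:\operatorname{dom}(E)\to H$ is bijective with bounded inverse, and put $\sigma(E)=\mathbb C\setminus\rho(E)$. A $C_0$-semigroup $(T(t))_{t\ge0}$ on $H$ is called similar to an isometric $C_0$-semigroup if there are a bounded, boundedly invertible operator $R$ on $H$ and a $C_0$-semigroup $(S(t))_{t\ge0}$ on $H$ consisting of isometries such that $RT(t)R^{-1}=S(t)$ for all $t\ge0$. All means below take values in $[0,\infty]$. Then the following are equivalent. 1. $E$ generates a $C_0$-semigroup $(T(t))_{t\ge0}$ on $H$ that is similar to an isometric $C_0$-semigroup. 2. $E$ generates a $C_0$-semigroup $(T(t))_{t\ge0}$ on $H$, and there exist a Hilbert space $K$ and a densely defined linear operator $C:\operatorname{dom}(C)\subseteq H\to K$ such that $T(t)\operatorname{dom}(C)\subseteq\operatorname{dom}(C)$ for all $t\ge0$; for every $h\in\operatorname{dom}(C)$ the map $[0,\infty)\to K$, $t\mapsto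 CT(t)h$, is Bochner measurable; and, for some $\alpha,\beta>0$, either $$\alpha\|h\|^2\le\limsup_{t\to\infty}\frac1t\int_0^t\|CT(s)h\|_K^2\,ds\le\beta\|h\|^2\quad\text{for all }h\in\operatorname{dom}(C),$$ or $$\alpha\|h\|^2\le\liminf_{t\to\infty}\frac1t\int_0^t\|CT(s)h\|_K^2\,ds\le\beta\|h\|^2\quad\text{for all }h\in\operatorname{dom}(C).$$ 3. $\sigma(E)\subseteq\{z\in\mathbb C:\operatorname{Re}z\le0\}$, and there exist a Hilbert space $K$ and a densely defined linear operator $C:\operatorname{dom}(C)\subseteq H\to K$ such that (a) $\operatorname{dom}(E)\subseteq\operatorname{dom}(C)$; (b) for all $\varepsilon>0$ and $h\in H$ the map $\mathbb R\to K$, $\xi\mapsto C(\varepsilon+i\xi-E)^{-1}h$, is Bochner measurable; (c) there exist $\alpha,\beta>0$ such that for all $h\in H$ $$\limsup_{\varepsilon\to0^+}\varepsilon\int_{-\infty}^\infty\|C(\varepsilon+i\xi-E)^{-1}h\|_K^2\,d\xi\le\beta\|h\|^2,\qquad \liminf_{\varepsilon\to0^+}\varepsilon\int_{-\infty}^\infty\|C(\varepsilon+i\xi-E)^{-1}h\|_K^2\,d\xi\ge\alpha\|h\|^2.$$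 -/

import Mathlib

open Filter MeasureTheory Topology

universe u

section SemigroupDefs

variable {H : Type u} [NormedAddCommGroup H] [InnerProductSpace ℂ H]

/-- `T` is a `C₀`-semigroup `(T(t))_{t ≥ 0}` of bounded operators on `H`.
The values of `T` at negative times are irrelevant. -/
structure IsC0Semigroup (T : ℝ → H →L[ℂ] H) : Prop where
  map_zero : T 0 = ContinuousLinearMap.id ℂ H
  map_add : ∀ s t : ℝ, 0 ≤ s → 0 ≤ t → T (s + t) = (T s).comp (T t)
  strongly_continuous : ∀ h : H, Tendsto (fun t : ℝ => T t h) (𝓝[>] 0) (𝓝 h)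

/-- The linear operator `E` is the generator of `T`: its graph consists of the pairs `(x, y)`
with `(T(t)x - x)/t → y` as `t → 0+`. -/
def IsGeneratorOf (E : H →ₗ.[ℂ] H) (T : ℝ → H →L[ℂ] H) : Prop :=
  ∀ x y : H, (x, y) ∈ E.graph ↔
    Tendsto (fun t : ℝ => ((t : ℂ)⁻¹) • (T t x - x)) (𝓝[>] 0) (𝓝 y)

/-- `T` is similar to an isometric `C₀`-semigroup: `R T(t) R⁻¹ = S(t)` for all `t ≥ 0`, with `R`
bounded and boundedly invertible and `S` a `C₀`-semigroup of isometries on `H`. -/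
def IsSimilarToIsometricSemigroup (T : ℝ → H →L[ℂ] H) : Prop :=
  ∃ (S : ℝ → H →L[ℂ] H) (R : H ≃L[ℂ] H), IsC0Semigroup S ∧
    (∀ t : ℝ, 0 ≤ t → ∀ h : H, ‖S t h‖ = ‖h‖) ∧
    ∀ t : ℝ, 0 ≤ t → ∀ h : H, R (T t (R.symm h)) = S t h

/-- The bounded operator `R` on `H` is the two-sided inverse `(z - E)⁻¹` of
`z - E : dom E → H`. -/
structure IsResolventAt (E : H →ₗ.[ℂ] H) (z : ℂ) (R : H →L[ℂ] H) : Prop where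
  right_inv : ∀ y : H, ∃ hy : R y ∈ E.domain, z • R y - E ⟨R y, hy⟩ = y
  left_inv : ∀ x : E.domain, R (z • (x : H) - E x) = x

/-- The resolvent set of a (not necessarily closed or densely defined) operator. -/
def operatorResolventSet (E : H →ₗ.[ℂ] H) : Set ℂ :=
  {z | ∃ R : H →L[ℂ] H, IsResolventAt E z R}

/-- The spectrum of a (not necessarily closed or densely defined) operator. -/
def operatorSpectrum (E : H →ₗ.[ℂ] H) : Set ℂ :=
  (operatorResolventSet E)ᶜ

open Classical in
/-- `(z - E)⁻¹` for `z` in the resolvent set (and `0` otherwise). -/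
noncomputable def operatorResolvent (E : H →ₗ.[ℂ] H) (z : ℂ) : H →L[ℂ] H :=
  if hz : ∃ R : H →L[ℂ] H, IsResolventAt E z R then hz.choose else 0

theorem isResolventAt_operatorResolvent {E : H →ₗ.[ℂ] H} {z : ℂ}
    (hz : z ∈ operatorResolventSet E) : IsResolventAt E z (operatorResolvent E z) := by
  have h : ∃ R : H →L[ℂ] H, IsResolventAt E z R := hz
  rw [operatorResolvent, dif_pos h]
  exact h.choose_spec

theorem IsResolventAt.unique {E : H →ₗ.[ℂ] H} {z : ℂ} {R R' : H →L[ℂ] H}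
    (hR : IsResolventAt E z R) (hR' : IsResolventAt E z R') : R = R' := by
  ext y
  obtain ⟨hy, e⟩ := hR'.right_inv y
  have := hR.left_inv ⟨R' y, hy⟩
  rwa [e] at this

variable {K : Type u} [NormedAddCommGroup K] [InnerProductSpace ℂ K]

open Classical in
/-- The value `C x` for `x ∈ dom C` (and `0` otherwise). -/
noncomputable def applyOp (C : H →ₗ.[ℂ] K) (x : H) : K :=
  if hx : x ∈ C.domain then C ⟨x, hx⟩ else 0

/-- The Cesàro mean `(1/t) ∫_0^t ‖C T(s) h‖² ds` (possibly `∞`), for `t > 0`. -/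
noncomputable def cesaroMean (C : H →ₗ.[ℂ] K) (T : ℝ → H →L[ℂ] H) (h : H) (t : ℝ) : ENNReal :=
  ENNReal.ofReal (1 / t) * ∫⁻ s in Set.Icc 0 t, ‖applyOp C (T s h)‖ₑ ^ 2

/-- The resolvent mean `ε ∫_ℝ ‖C (ε + iξ - E)⁻¹ h‖² dξ` (possibly `∞`), for `ε > 0`. -/
noncomputable def resolventMean (C : H →ₗ.[ℂ] K) (E : H →ₗ.[ℂ] H) (h : H) (ε : ℝ) : ENNReal :=
  ENNReal.ofReal ε *
    ∫⁻ ξ : ℝ, ‖applyOp C (operatorResolvent E ((ε : ℂ) + (ξ : ℂ) * Complex.I) h)‖ₑ ^ 2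

/-- The domain of `C` is dense and invariant under `T(t)`, `t ≥ 0`, and the weighted orbits
`t ↦ C T(t) h`, `t ≥ 0`, `h ∈ dom C`, are Bochner measurable. -/
structure IsSemigroupWeight (C : H →ₗ.[ℂ] K) (T : ℝ → H →L[ℂ] H) : Prop where
  dense : Dense (C.domain : Set H)
  invariant : ∀ t : ℝ, 0 ≤ t → ∀ h ∈ C.domain, T t h ∈ C.domain
  measurable : ∀ h ∈ C.domain,
    AEStronglyMeasurable (fun t : ℝ => applyOp C (T t h)) (volume.restrict (Set.Ici 0))

/-- The domain of `C` is dense and contains `dom E`, and the maps `ξ ↦ C (ε + iξ - E)⁻¹ h`,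
`ε > 0`, `h ∈ H`, are Bochner measurable on `ℝ`. -/
structure IsResolventWeight (C : H →ₗ.[ℂ] K) (E : H →ₗ.[ℂ] H) : Prop where
  dense : Dense (C.domain : Set H)
  domain_le : E.domain ≤ C.domain
  measurable : ∀ ε : ℝ, 0 < ε → ∀ h : H,
    AEStronglyMeasurable
      (fun ξ : ℝ => applyOp C (operatorResolvent E ((ε : ℂ) + (ξ : ℂ) * Complex.I) h)) volume

end SemigroupDefs

/-! ### Estimates for `exp (t • A)` with `A` bounded -/

section ExpSemigroup

open NormedSpace

variable {H : Type u} [NormedAddCommGroup H] [InnerProductSpace ℂ H] [CompleteSpace H]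

/-! The pivot is the estimate `m‖h‖² ≤ ‖T(t)h‖² ≤ M‖h‖²` with `m > 0`, uniform in `t ≥ 0`, which is
equivalent to similarity to an isometric semigroup. Similarity gives it at once. Conversely, the
Gram forms `(1/t)∫₀ᵗ ⟨T(s)x, T(s)y⟩ ds` are bounded and converge to some `⟨Qx, y⟩` along an
ultrafilter at infinity. Replacing `x` by `T(τ)x` changes the mean square of the orbit of `x` by
`O(1/t)`, so the limit form is `T`-invariant; the lower bound makes `Q` invertible, and conjugation
by `√Q` produces isometries (`IsC0Semigroup.isSimilarToIsometricSemigroup`).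

Condition 2 gives the estimate because the weighted Cesàro means of `h` and `T(τ)h` are comparable
as `t → ∞`, with constants independent of `τ` (`IsSemigroupWeight.norm_sq_bounds`).

Condition 3 provides no semigroup. An ultrafilter limit, as `ε → 0+`, of the Gram forms behind the
resolvent means gives a positive `Q` with `⟨Qx, x⟩` comparable to `‖x‖²`, and the equation `(z -
E)⁻¹(zg - Eg) = g` forces `Re⟨QEg, g⟩ = 0` (`IsResolventWeight.exists_form`). In the norm of `Q` the
operators `r(r - E)⁻¹` are then contractions, so Hille–Yosida yields a semigroup, isometric for `Q`
(`exists_isC0Semigroup_of_skew`), and the estimate follows.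

For the implications from 1, the weight is the identity. The Cesàro bounds are immediate. On a
vertical line the resolvent is the Fourier transform of `e^{-εt}T(t)h`, so Plancherel turns the
resolvent mean into `2πε∫₀^∞ e^{-2εt}‖T(t)h‖² dt`, which lies between `πm‖h‖²` and `πM‖h‖²`. -/

theorem hasDerivAt_exp_smul_apply (A : H →L[ℂ] H) (x : H) (t : ℝ) :
    HasDerivAt (fun s : ℝ => exp (s • A) x) (exp (t • A) (A x)) t := by
  have h := ((ContinuousLinearMap.apply ℂ H x).restrictScalars ℝ).hasFDerivAt.comp_hasDerivAt t
    (hasDerivAt_exp_smul_const A t)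
  simpa [Function.comp_def] using h

theorem exp_add_eq_mul_of_commute {A B : H →L[ℂ] H} (h : Commute A B) :
    exp (A + B) = exp A * exp B :=
  letI : NormedAlgebra ℚ (H →L[ℂ] H) := NormedAlgebra.restrictScalars ℚ ℝ _
  exp_add_of_commute h

theorem exp_add_smul (A : H →L[ℂ] H) (s t : ℝ) :
    exp ((s + t) • A) = exp (s • A) * exp (t • A) := by
  rw [add_smul]
  exact exp_add_eq_mul_of_commute (((Commute.refl A).smul_left s).smul_right t)

theorem norm_exp_smul_apply_sub_le {A : H →L[ℂ] H} {M : ℝ}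
    (hA : ∀ t : ℝ, 0 ≤ t → ∀ x, ‖exp (t • A) x‖ ≤ M * ‖x‖) {t : ℝ} (ht : 0 ≤ t) (x : H) :
    ‖exp (t • A) x - x‖ ≤ t * (M * ‖A x‖) := by
  have h := norm_image_sub_le_of_norm_deriv_le_segment' (a := 0) (b := t)
    (fun s _ => (hasDerivAt_exp_smul_apply A x s).hasDerivWithinAt)
    (fun s hs => hA s hs.1 (A x)) t ⟨ht, le_rfl⟩
  simpa [mul_comm t] using h

theorem norm_exp_smul_apply_sub_sub_le {A : H →L[ℂ] H} {δ t : ℝ} (ht : 0 ≤ t) (x : H)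
    (h : ∀ s ∈ Set.Icc 0 t, ‖exp (s • A) (A x) - A x‖ ≤ δ) :
    ‖exp (t • A) x - x - t • A x‖ ≤ t * δ := by
  have hd : ∀ s : ℝ, HasDerivAt (fun s : ℝ => exp (s • A) x - s • A x)
      (exp (s • A) (A x) - A x) s := fun s => by
    simpa using (hasDerivAt_exp_smul_apply A x s).fun_sub ((hasDerivAt_id s).smul_const (A x))
  have h := norm_image_sub_le_of_norm_deriv_le_segment' (a := 0) (b := t)
    (fun s _ => (hd s).hasDerivWithinAt) (fun s hs => h s ⟨hs.1, hs.2.le⟩) t ⟨ht, le_rfl⟩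
  rw [show exp (t • A) x - x - t • A x = exp (t • A) x - t • A x - x by abel]
  simpa [mul_comm t] using h

/-- For commuting `A` and `B`, the curve `s ↦ e^{s(A-B)}e^{tB}x` joins `e^{tB}x` to `e^{tA}x`, and
its derivative is `e^{sA}e^{(t-s)B}(A-B)x`, in which both exponents are nonnegative. This makes the
exponentials of the Yosida approximations Cauchy. -/
theorem norm_exp_smul_sub_exp_smul_le {A B : H →L[ℂ] H} (hAB : Commute A B) {M : ℝ} (hM : 0 ≤ M)
    (hA : ∀ t : ℝ, 0 ≤ t → ∀ x, ‖exp (t • A) x‖ ≤ M * ‖x‖)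
    (hB : ∀ t : ℝ, 0 ≤ t → ∀ x, ‖exp (t • B) x‖ ≤ M * ‖x‖) {t : ℝ} (ht : 0 ≤ t) (x : H) :
    ‖exp (t • A) x - exp (t • B) x‖ ≤ t * (M * (M * ‖A x - B x‖)) := by
  have hc : ∀ s r : ℝ, Commute (s • A) (r • B) := fun s r => (hAB.smul_left s).smul_right r
  have hsplit : ∀ s : ℝ, exp (s • (A - B)) * exp (t • B) = exp (s • A) * exp ((t - s) • B) := by
    intro s
    rw [← exp_add_eq_mul_of_commute, ← exp_add_eq_mul_of_commute (hc _ _)]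
    · congr 1; module
    · exact ((hAB.sub_left (Commute.refl B)).smul_left s).smul_right t
  have hcomm : ∀ s r : ℝ, Commute (exp (s • (A - B)) * exp (r • B)) (A - B) := by
    intro s r
    refine Commute.mul_left ?_ ?_
    · exact (((Commute.refl (A - B)).smul_left s).exp_left)
    · exact (((hAB.symm.sub_right (Commute.refl B)).smul_left r).exp_left)
  have hbound : ∀ s ∈ Set.Ico 0 t,
      ‖exp (s • (A - B)) ((A - B) (exp (t • B) x))‖ ≤ M * (M * ‖A x - B x‖) := by
    intro s hs
    have e : exp (s • (A - B)) ((A - B) (exp (t • B) x))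
        = exp (s • A) (exp ((t - s) • B) (A x - B x)) := by
      have h1 := hcomm s t
      have h2 : exp (s • (A - B)) * (A - B) = (A - B) * exp (s • (A - B)) :=
        ((Commute.refl (A - B)).smul_left s).exp_left
      have : exp (s • (A - B)) * (A - B) * exp (t • B)
          = exp (s • A) * exp ((t - s) • B) * (A - B) := by
        rw [h2, mul_assoc, ← h1.eq, hsplit]
      exact congrArg (fun f : H →L[ℂ] H => f x) this
    rw [e]
    exact (hA s hs.1 _).trans (mul_le_mul_of_nonneg_left (hB _ (by linarith [hs.2]) _) hM)
  have h := norm_image_sub_le_of_norm_deriv_le_segment' (a := 0) (b := t)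
    (fun s _ => (hasDerivAt_exp_smul_apply (A - B) (exp (t • B) x) s).hasDerivWithinAt)
    hbound t ⟨ht, le_rfl⟩
  have e : exp (t • (A - B)) (exp (t • B) x) = exp (t • A) x := by
    have := hsplit t
    rw [sub_self, zero_smul, exp_zero, mul_one] at this
    exact congrArg (fun f : H →L[ℂ] H => f x) this
  rw [e] at h
  simpa [mul_comm t] using h

theorem norm_exp_smul_apply_le_of_norm_pow_le {B : H →L[ℂ] H} {M : ℝ}
    (hB : ∀ (k : ℕ) x, ‖(B ^ k) x‖ ≤ M * ‖x‖) {t : ℝ} (ht : 0 ≤ t) (x : H) :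
    ‖exp (t • B) x‖ ≤ Real.exp t * (M * ‖x‖) := by
  have hterm : ∀ n : ℕ, ((n.factorial : ℝ)⁻¹ • (t • B) ^ n : H →L[ℂ] H) x
      = ((n.factorial : ℝ)⁻¹ * t ^ n) • (B ^ n) x := by
    intro n
    rw [smul_pow, smul_smul, smul_apply]
  have hs : HasSum (fun n : ℕ => ((n.factorial : ℝ)⁻¹ • (t • B) ^ n : H →L[ℂ] H)) (exp (t • B)) :=
    exp_series_hasSum_exp' (𝕂 := ℝ) (t • B)
  have hs' : HasSum (fun n : ℕ => ((n.factorial : ℝ)⁻¹ * t ^ n) • (B ^ n) x) (exp (t • B) x) := by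
    simpa only [ContinuousLinearMap.apply_apply, hterm] using
      (ContinuousLinearMap.apply ℂ H x).hasSum hs
  have hr : HasSum (fun n : ℕ => ((n.factorial : ℝ)⁻¹ * t ^ n) * (M * ‖x‖))
      (Real.exp t * (M * ‖x‖)) := by
    have h := exp_series_hasSum_exp' (𝕂 := ℝ) t
    rw [← Real.exp_eq_exp_ℝ] at h
    exact h.mul_right _
  refine hs'.norm_le_of_bounded hr fun n => ?_
  have hn : 0 ≤ (n.factorial : ℝ)⁻¹ * t ^ n := by positivity
  rw [norm_smul, Real.norm_of_nonneg hn]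
  exact mul_le_mul_of_nonneg_left (hB n x) hn

end ExpSemigroup

/-! ### Orbits of bounded semigroups -/

section BoundedSemigroup

variable {H : Type u} [NormedAddCommGroup H] [InnerProductSpace ℂ H]
variable {T : ℝ → H →L[ℂ] H} {M : ℝ}

/-- The values of `T` at negative times are arbitrary; composing with `|·|` gives a two-sided limit
that avoids them. -/
theorem IsC0Semigroup.tendsto_abs (hT : IsC0Semigroup T) (h : H) :
    Tendsto (fun r : ℝ => T |r| h) (𝓝 0) (𝓝 h) := by
  have h0 : T 0 h = h := by simp [hT.map_zero]
  have h1 : ContinuousWithinAt (fun t : ℝ => T t h) (Set.Ici 0) 0 := by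
    rw [← continuousWithinAt_Ioi_iff_Ici]
    simpa [ContinuousWithinAt, h0] using hT.strongly_continuous h
  have h2 : Tendsto (fun r : ℝ => |r|) (𝓝 0) (𝓝[Set.Ici 0] 0) := by
    refine tendsto_nhdsWithin_iff.2 ⟨by simpa using (continuous_abs.tendsto (0 : ℝ)), ?_⟩
    exact Eventually.of_forall fun r => abs_nonneg r
  have h3 := h1.tendsto.comp h2
  simpa [Function.comp_def, h0] using h3

theorem IsC0Semigroup.apply_add (hT : IsC0Semigroup T) {s t : ℝ} (hs : 0 ≤ s) (ht : 0 ≤ t) (h : H) :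
    T (s + t) h = T s (T t h) := by
  rw [hT.map_add s t hs ht]; rfl

theorem IsC0Semigroup.continuousOn_orbit (hT : IsC0Semigroup T)
    (hM : ∀ t : ℝ, 0 ≤ t → ∀ h, ‖T t h‖ ≤ M * ‖h‖) (h : H) :
    ContinuousOn (fun t => T t h) (Set.Ici 0) := by
  intro t ht
  have hle : ∀ a b : ℝ, 0 ≤ a → a ≤ b → ‖T b h - T a h‖ ≤ M * ‖T |b - a| h - h‖ := by
    intro a b ha hab
    have : T b h = T a (T |b - a| h) := by
      rw [← hT.apply_add ha (abs_nonneg _), abs_of_nonneg (by linarith)]; simp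
    rw [this, ← map_sub]
    exact hM a ha _
  have hlim : Tendsto (fun s : ℝ => M * ‖T |s - t| h - h‖) (𝓝[Set.Ici 0] t) (𝓝 0) := by
    have h1 : Tendsto (fun s : ℝ => s - t) (𝓝[Set.Ici 0] t) (𝓝 0) := by
      have : Tendsto (fun s : ℝ => s - t) (𝓝 t) (𝓝 (t - t)) :=
        (continuous_id.sub continuous_const).tendsto t
      rw [sub_self] at this
      exact this.mono_left nhdsWithin_le_nhds
    have h2 := (((hT.tendsto_abs h).comp h1).sub_const h).norm.const_mul M
    simpa [Function.comp_def] using h2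
  rw [ContinuousWithinAt, tendsto_iff_norm_sub_tendsto_zero]
  refine squeeze_zero' (Eventually.of_forall fun _ => norm_nonneg _) ?_ hlim
  filter_upwards [self_mem_nhdsWithin] with s hs
  rcases le_total t s with hts | hst
  · exact hle t s ht hts
  · rw [norm_sub_rev, abs_sub_comm]
    exact hle s t hs hst

theorem IsC0Semigroup.hasDerivWithinAt_orbit (hT : IsC0Semigroup T) {x y : H}
    (hxy : Tendsto (fun t : ℝ => ((t : ℂ)⁻¹) • (T t x - x)) (𝓝[>] 0) (𝓝 y)) {t : ℝ} (ht : 0 ≤ t) :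
    HasDerivWithinAt (fun s => T s x) (T t y) (Set.Ici t) t := by
  rw [← hasDerivWithinAt_Ioi_iff_Ici,
    hasDerivWithinAt_iff_tendsto_slope' (by simp)]
  have h1 : Tendsto (fun s : ℝ => s - t) (𝓝[>] t) (𝓝[>] 0) := by
    refine tendsto_nhdsWithin_iff.2 ⟨?_, ?_⟩
    · have : Tendsto (fun s : ℝ => s - t) (𝓝 t) (𝓝 (t - t)) :=
        (continuous_id.sub continuous_const).tendsto t
      rw [sub_self] at this
      exact this.mono_left nhdsWithin_le_nhds
    · filter_upwards [self_mem_nhdsWithin] with s hs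
      exact sub_pos.2 (Set.mem_Ioi.1 hs)
  have h2 := ((T t).continuous.tendsto y).comp (hxy.comp h1)
  refine h2.congr' ?_
  filter_upwards [self_mem_nhdsWithin] with s hs
  have hs' : t < s := hs
  have e : T s x = T t (T (s - t) x) := by
    rw [← hT.apply_add ht (by linarith)]; simp
  simp only [Function.comp_apply, slope, vsub_eq_sub, e]
  rw [map_smul, map_sub]
  rw [← Complex.ofReal_inv, Complex.coe_smul]

/-- The function `e^{-zt}T(t)x` has zero right derivative, so it equals `x`, yet its norm is at most
`e^{-t Re z}M‖x‖`, which tends to `0`. This replaces an injectivity argument for `z` minus the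
generator. -/
theorem IsC0Semigroup.eq_zero_of_eigenvector (hT : IsC0Semigroup T)
    (hM : ∀ t : ℝ, 0 ≤ t → ∀ h, ‖T t h‖ ≤ M * ‖h‖) {z : ℂ} (hz : 0 < z.re) {x : H}
    (hx : Tendsto (fun t : ℝ => ((t : ℂ)⁻¹) • (T t x - x)) (𝓝[>] 0) (𝓝 (z • x))) : x = 0 := by
  have hexp : ∀ t : ℝ, HasDerivAt (fun s : ℝ => Complex.exp (-z * s)) (-z * Complex.exp (-z * t)) t := by
    intro t
    have h1 : HasDerivAt (fun s : ℝ => -z * (s : ℂ)) (-z) t := by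
      simpa using (Complex.ofRealCLM.hasDerivAt (x := t)).const_mul (-z)
    simpa [mul_comm] using h1.cexp
  have key : ∀ t : ℝ, 0 ≤ t → Complex.exp (-z * t) • T t x = x := by
    intro t ht
    have hc : ContinuousOn (fun s : ℝ => Complex.exp (-z * s) • T s x) (Set.Icc 0 t) := by
      refine ContinuousOn.smul ?_ ((hT.continuousOn_orbit hM x).mono Set.Icc_subset_Ici_self)
      exact (Complex.continuous_exp.comp
        (continuous_const.mul Complex.continuous_ofReal)).continuousOn
    have := constant_of_has_deriv_right_zero hc (fun s hs => by
      have h := (hexp s).hasDerivWithinAt.fun_smul (hT.hasDerivWithinAt_orbit hx hs.1)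
      convert h using 1
      rw [map_smul, smul_smul, ← add_smul]
      have : Complex.exp (-z * s) * z + -z * Complex.exp (-z * s) = 0 := by ring
      rw [this, zero_smul]) t ⟨ht, le_rfl⟩
    rw [this]
    simp [hT.map_zero]
  have hle : ∀ t : ℝ, 0 ≤ t → ‖x‖ ≤ Real.exp (-z.re * t) * (M * ‖x‖) := by
    intro t ht
    conv_lhs => rw [← key t ht]
    rw [norm_smul, Complex.norm_exp]
    have : (-z * (t : ℂ)).re = -z.re * t := by simp
    rw [this]
    exact mul_le_mul_of_nonneg_left (hM t ht x) (Real.exp_nonneg _)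
  have hlim : Tendsto (fun t : ℝ => Real.exp (-z.re * t) * (M * ‖x‖)) atTop (𝓝 (0 * (M * ‖x‖))) := by
    refine Tendsto.mul_const _ (Real.tendsto_exp_atBot.comp ?_)
    exact tendsto_id.const_mul_atTop_of_neg (by linarith)
  have := ge_of_tendsto hlim ((eventually_ge_atTop 0).mono hle)
  rw [zero_mul] at this
  exact norm_le_zero_iff.1 this

end BoundedSemigroup

/-! ### Resolvent identities and the Hille–Yosida theorem -/

section HilleYosida

open NormedSpace

variable {H : Type u} [NormedAddCommGroup H] [InnerProductSpace ℂ H]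

theorem norm_apply_sub_le_add {U : H →L[ℂ] H} {M : ℝ} (hU : ∀ x, ‖U x‖ ≤ M * ‖x‖) (x y : H) :
    ‖U x - x‖ ≤ (M + 1) * ‖x - y‖ + ‖U y - y‖ := by
  have e : U x - x = U (x - y) - (x - y) + (U y - y) := by rw [map_sub]; abel
  calc ‖U x - x‖ ≤ ‖U (x - y)‖ + ‖x - y‖ + ‖U y - y‖ := by
        rw [e]; exact (norm_add_le _ _).trans (add_le_add_left (norm_sub_le _ _) _)
    _ ≤ (M + 1) * ‖x - y‖ + ‖U y - y‖ := by linarith [hU (x - y)]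

/-- A bounded semigroup whose generator extends `E` is generated by `E` as soon as some `z` in the
open right half-plane belongs to the resolvent set of `E`. -/
theorem IsC0Semigroup.isGeneratorOf_of_resolvent {T : ℝ → H →L[ℂ] H} (hT : IsC0Semigroup T) {M : ℝ}
    (hM : ∀ t : ℝ, 0 ≤ t → ∀ h, ‖T t h‖ ≤ M * ‖h‖) {E : H →ₗ.[ℂ] H}
    (hE : ∀ x : E.domain, Tendsto (fun t : ℝ => ((t : ℂ)⁻¹) • (T t x - x)) (𝓝[>] 0) (𝓝 (E x)))
    {z : ℂ} (hz : 0 < z.re) {R : H →L[ℂ] H} (hR : IsResolventAt E z R) : IsGeneratorOf E T := by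
  intro x y
  refine ⟨fun h => ?_, fun h => ?_⟩
  · obtain ⟨w, hw, hw'⟩ := (LinearPMap.mem_graph_iff E).1 h
    simp only at hw hw'
    rw [← hw, ← hw']
    exact hE w
  · obtain ⟨hw, e⟩ := hR.right_inv (z • x - y)
    set w : E.domain := ⟨R (z • x - y), hw⟩ with hwdef
    have hEw : E w = z • (w : H) - (z • x - y) := by
      rw [← e]; simp [hwdef]
    -- Since `(z - E)w = zx - y`, the difference `x - w` is an eigenvector of the generator of `T`
    -- for `z`, hence zero.
    have hsub : Tendsto (fun t : ℝ => ((t : ℂ)⁻¹) • (T t (x - w) - (x - w))) (𝓝[>] 0)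
        (𝓝 (z • (x - (w : H)))) := by
      have h3 := h.sub (hE w)
      have e1 : y - E w = z • (x - (w : H)) := by rw [hEw, smul_sub]; abel
      rw [e1] at h3
      refine h3.congr fun t => ?_
      rw [← smul_sub, map_sub]; congr 1; abel
    have h0 := hT.eq_zero_of_eigenvector hM hz hsub
    rw [sub_eq_zero] at h0
    rw [LinearPMap.mem_graph_iff]
    refine ⟨w, h0.symm, ?_⟩
    simp only
    rw [hEw, ← h0]; abel

theorem IsResolventAt.mem_domain {E : H →ₗ.[ℂ] H} {z : ℂ} {R : H →L[ℂ] H}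
    (hR : IsResolventAt E z R) (y : H) : R y ∈ E.domain := (hR.right_inv y).1

theorem IsResolventAt.apply_eq {E : H →ₗ.[ℂ] H} {z : ℂ} {R : H →L[ℂ] H}
    (hR : IsResolventAt E z R) (y : H) : E ⟨R y, hR.mem_domain y⟩ = z • R y - y := by
  obtain ⟨hy, e⟩ := hR.right_inv y
  rw [eq_sub_iff_add_eq, ← eq_sub_iff_add_eq']
  exact e.symm

theorem IsResolventAt.sub_apply {E : H →ₗ.[ℂ] H} {z w : ℂ} {R S : H →L[ℂ] H}
    (hR : IsResolventAt E z R) (hS : IsResolventAt E w S) (y : H) :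
    R y - S y = (w - z) • R (S y) := by
  have h := hR.left_inv ⟨S y, hS.mem_domain y⟩
  rw [hS.apply_eq] at h
  have e : z • S y - (w • S y - y) = y - (w - z) • S y := by rw [sub_smul]; abel
  simp only [e] at h
  rw [map_sub, map_smul] at h
  rw [sub_eq_iff_eq_add] at h ⊢
  rw [h, add_comm]

theorem IsResolventAt.commute {E : H →ₗ.[ℂ] H} {z w : ℂ} {R S : H →L[ℂ] H}
    (hR : IsResolventAt E z R) (hS : IsResolventAt E w S) : Commute R S := by
  by_cases hzw : w = z
  · subst hzw
    rw [hR.unique hS]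
  · ext y
    have h1 := hR.sub_apply hS y
    have h2 := hS.sub_apply hR y
    have h3 : (w - z) • R (S y) = (w - z) • S (R y) := by
      rw [← h1, ← neg_sub (S y), h2, ← neg_smul, neg_sub]
    exact smul_right_injective H (sub_ne_zero.2 hzw) h3

variable [CompleteSpace H]

/-- Equicontinuity at time zero: on `dom E` the sequence `A n x` converges, hence is eventually
bounded, so the orbits of `x` are Lipschitz with one constant. Density and the uniform bound `M`
extend this to every `y`. -/
theorem exists_forall_norm_exp_smul_apply_sub_le {A : ℕ → H →L[ℂ] H} {E : H →ₗ.[ℂ] H}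
    (hE : Dense (E.domain : Set H)) {M : ℝ} (hM : 0 ≤ M)
    (hA : ∀ n (t : ℝ), 0 ≤ t → ∀ x, ‖exp (t • A n) x‖ ≤ M * ‖x‖)
    (hlim : ∀ x : E.domain, Tendsto (fun n => A n x) atTop (𝓝 (E x))) (y : H) {ε : ℝ} (hε : 0 < ε) :
    ∃ δ : ℝ, 0 < δ ∧ ∀ᶠ n in atTop, ∀ s ∈ Set.Icc 0 δ, ‖exp (s • A n) y - y‖ ≤ ε := by
  obtain ⟨x, hx, hxy⟩ := hE.exists_dist_lt y (ε := ε / (2 * (M + 1))) (by positivity)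
  rw [dist_eq_norm, lt_div_iff₀ (by positivity)] at hxy
  set c : ℝ := ‖E ⟨x, hx⟩‖ + 1 with hc
  have hc0 : 0 < c := by positivity
  refine ⟨ε / (2 * (M + 1) * c), by positivity, ?_⟩
  have hev : ∀ᶠ n in atTop, ‖A n x‖ < c :=
    (hlim ⟨x, hx⟩).norm.eventually_lt_const (by linarith)
  filter_upwards [hev] with n hn s hs
  have h1 := norm_apply_sub_le_add (hA n s hs.1) y x
  have h2 := norm_exp_smul_apply_sub_le (hA n) hs.1 x
  have h3 : s * (M * ‖A n x‖) ≤ ε / 2 := by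
    have h4 : s * (M * ‖A n x‖) ≤ ε / (2 * (M + 1) * c) * ((M + 1) * c) := by
      refine mul_le_mul hs.2 ?_ (by positivity) (by positivity)
      exact mul_le_mul (by linarith) hn.le (norm_nonneg _) (by positivity)
    have h5 : ε / (2 * (M + 1) * c) * ((M + 1) * c) = ε / 2 := by
      field_simp
    linarith
  nlinarith

theorem exists_tendsto_exp_smul_apply {A : ℕ → H →L[ℂ] H} {E : H →ₗ.[ℂ] H}
    (hE : Dense (E.domain : Set H)) {M : ℝ} (hM : 0 ≤ M) (hcomm : ∀ m n, Commute (A m) (A n))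
    (hA : ∀ n (t : ℝ), 0 ≤ t → ∀ x, ‖exp (t • A n) x‖ ≤ M * ‖x‖)
    (hlim : ∀ x : E.domain, Tendsto (fun n => A n x) atTop (𝓝 (E x))) {t : ℝ} (ht : 0 ≤ t) (y : H) :
    ∃ z, Tendsto (fun n => exp (t • A n) y) atTop (𝓝 z) := by
  refine cauchySeq_tendsto_of_complete (Metric.cauchySeq_iff.2 fun ε hε => ?_)
  obtain ⟨x, hx, hxy⟩ := hE.exists_dist_lt y (ε := ε / (4 * (M + 1))) (by positivity)
  rw [dist_eq_norm, lt_div_iff₀ (by positivity)] at hxy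
  set c : ℝ := t * (M * M) + 1 with hc
  have hc0 : 0 < c := by positivity
  obtain ⟨N, hN⟩ := Metric.cauchySeq_iff.1 (hlim ⟨x, hx⟩).cauchySeq (ε / (2 * c)) (by positivity)
  refine ⟨N, fun m hm n hn => ?_⟩
  have h1 := norm_exp_smul_sub_exp_smul_le (hcomm m n) hM (hA m) (hA n) ht x
  have h2 := hN m hm n hn
  rw [dist_eq_norm, lt_div_iff₀ (by positivity)] at h2
  have h3 := hA m t ht (y - x)
  have h4 := hA n t ht (y - x)
  have e : exp (t • A m) y - exp (t • A n) y
      = exp (t • A m) (y - x) + (exp (t • A m) x - exp (t • A n) x) - exp (t • A n) (y - x) := by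
    rw [map_sub, map_sub]; abel
  rw [dist_eq_norm, e]
  refine (norm_sub_le _ _).trans_lt ((add_le_add_left (norm_add_le _ _) _).trans_lt ?_)
  have h5 : t * (M * (M * ‖A m x - A n x‖)) ≤ ‖A m x - A n x‖ * c := by
    have := norm_nonneg (A m x - A n x)
    rw [hc]; nlinarith
  have h6 : ‖A m x - A n x‖ * (2 * c) < ε := h2
  have h7 := norm_nonneg (y - x)
  nlinarith

theorem exists_isC0Semigroup_of_tendsto {A : ℕ → H →L[ℂ] H} {E : H →ₗ.[ℂ] H}
    (hE : Dense (E.domain : Set H)) {M : ℝ} (hM : 0 ≤ M) (hcomm : ∀ m n, Commute (A m) (A n))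
    (hA : ∀ n (t : ℝ), 0 ≤ t → ∀ x, ‖exp (t • A n) x‖ ≤ M * ‖x‖)
    (hlim : ∀ x : E.domain, Tendsto (fun n => A n x) atTop (𝓝 (E x))) :
    ∃ T : ℝ → H →L[ℂ] H, IsC0Semigroup T ∧ (∀ t : ℝ, 0 ≤ t → ∀ x, ‖T t x‖ ≤ M * ‖x‖) ∧
      ∀ x : E.domain, Tendsto (fun t : ℝ => ((t : ℂ)⁻¹) • (T t x - x)) (𝓝[>] 0) (𝓝 (E x)) := by
  have hex : ∀ t : ℝ, ∃ V : H →L[ℂ] H, 0 ≤ t → ∀ x,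
      Tendsto (fun n => exp (t • A n) x) atTop (𝓝 (V x)) := by
    intro t
    by_cases ht : 0 ≤ t
    · choose z hz using exists_tendsto_exp_smul_apply hE hM hcomm hA hlim ht
      exact ⟨continuousLinearMapOfTendsto (fun n => exp (t • A n)) (tendsto_pi_nhds.2 hz),
        fun _ => hz⟩
    · exact ⟨0, fun h => absurd h ht⟩
  choose T hT using hex
  have hTM : ∀ t : ℝ, 0 ≤ t → ∀ x, ‖T t x‖ ≤ M * ‖x‖ := fun t ht x =>
    le_of_tendsto (hT t ht x).norm (Eventually.of_forall fun n => hA n t ht x)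
  refine ⟨T, ⟨?_, ?_, ?_⟩, hTM, ?_⟩
  · ext x
    refine tendsto_nhds_unique (hT 0 le_rfl x) ?_
    simp
  · intro s t hs ht
    ext x
    refine tendsto_nhds_unique (hT (s + t) (add_nonneg hs ht) x) ?_
    have h1 : Tendsto (fun n => exp (s • A n) (exp (t • A n) x - T t x)) atTop (𝓝 0) := by
      refine squeeze_zero_norm (fun n => hA n s hs _) ?_
      simpa using (((hT t ht x).sub_const (T t x)).norm.const_mul M)
    have h2 := h1.add (hT s hs (T t x))
    rw [zero_add] at h2
    refine h2.congr fun n => ?_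
    rw [← map_add, sub_add_cancel, exp_add_smul]; rfl
  · intro y
    rw [Metric.tendsto_nhds]
    intro ε hε
    obtain ⟨δ, hδ, h⟩ := exists_forall_norm_exp_smul_apply_sub_le hE hM hA hlim y (half_pos hε)
    filter_upwards [Ioo_mem_nhdsGT hδ] with t ht
    rw [dist_eq_norm]
    refine lt_of_le_of_lt ?_ (half_lt_self hε)
    refine le_of_tendsto ((hT t ht.1.le y).sub_const y).norm ?_
    filter_upwards [h] with n hn
    exact hn t ⟨ht.1.le, ht.2.le⟩
  · intro x
    rw [Metric.tendsto_nhds]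
    intro ε hε
    obtain ⟨δ, hδ, h⟩ := exists_forall_norm_exp_smul_apply_sub_le hE hM hA hlim (E x)
      (half_pos (half_pos hε))
    have hev : ∀ᶠ n in atTop, ‖A n x - E x‖ < ε / 4 / (M + 1) := by
      have := (hlim x).sub_const (E x)
      rw [sub_self] at this
      exact this.norm.eventually_lt_const (by rw [norm_zero]; positivity)
    filter_upwards [Ioo_mem_nhdsGT hδ] with t ht
    -- Pass to the limit in the estimate for `A n`. The vector `A n x` moves with `n`, so
    -- equicontinuity is applied at the fixed vector `E x`, at the cost of `(M + 1)‖A n x - E x‖`.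
    have key : ‖T t x - x - t • E x‖ ≤ t * (ε / 2) := by
      refine le_of_tendsto (((hT t ht.1.le x).sub_const (x : H)).sub ((hlim x).const_smul t)).norm ?_
      filter_upwards [h, hev] with n hn hn'
      refine norm_exp_smul_apply_sub_sub_le ht.1.le (x : H) fun s hs => ?_
      have h1 := norm_apply_sub_le_add (hA n s hs.1) (A n x) (E x)
      have h2 := hn s ⟨hs.1, hs.2.trans ht.2.le⟩
      rw [lt_div_iff₀ (by positivity)] at hn'
      linarith
    rw [dist_eq_norm]
    have ht0 : (0 : ℝ) < t := ht.1
    have e : ((t : ℂ)⁻¹) • (T t x - x) - E x = (t⁻¹ : ℝ) • (T t x - x - t • E x) := by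
      rw [← Complex.ofReal_inv, Complex.coe_smul, smul_sub (t⁻¹) _ (t • E x),
        inv_smul_smul₀ ht0.ne']
    rw [e, norm_smul, norm_inv, Real.norm_of_nonneg ht0.le]
    calc t⁻¹ * ‖T t x - x - t • E x‖ ≤ t⁻¹ * (t * (ε / 2)) := by gcongr
      _ = ε / 2 := by field_simp
      _ < ε := half_lt_self hε

/-- **Hille–Yosida theorem** for bounded semigroups. -/
theorem exists_isC0Semigroup_of_norm_resolvent_pow_le {E : H →ₗ.[ℂ] H}
    (hE : Dense (E.domain : Set H)) {M : ℝ} (hM : 0 ≤ M) {R : ℝ → H →L[ℂ] H}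
    (hR : ∀ r : ℝ, 0 < r → IsResolventAt E r (R r))
    (hRM : ∀ r : ℝ, 0 < r → ∀ (k : ℕ) x, ‖((r • R r) ^ k) x‖ ≤ M * ‖x‖) :
    ∃ T : ℝ → H →L[ℂ] H, IsC0Semigroup T ∧ IsGeneratorOf E T ∧
      ∀ t : ℝ, 0 ≤ t → ∀ x, ‖T t x‖ ≤ M * ‖x‖ := by
  have hR1 : ∀ r : ℝ, 0 < r → ∀ x, ‖r • R r x‖ ≤ M * ‖x‖ := fun r hr x => by
    simpa using hRM r hr 1 x
  -- Yosida approximation: `J n → 1` strongly, and `A n = (n+1)(J n - 1)` agrees with `J n E` on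
  -- `dom E`. The shift to `n + 1` keeps the resolvent point positive.
  set J : ℕ → H →L[ℂ] H := fun n => ((n : ℝ) + 1) • R ((n : ℝ) + 1) with hJ
  have hpos : ∀ n : ℕ, (0 : ℝ) < (n : ℝ) + 1 := fun n => by positivity
  have hJM : ∀ n x, ‖J n x‖ ≤ M * ‖x‖ := fun n x => hR1 _ (hpos n) x
  have hcJ : ∀ m n, Commute (J m) (J n) := fun m n =>
    (((hR _ (hpos m)).commute (hR _ (hpos n))).smul_left _).smul_right _
  have hJdom : ∀ x : E.domain, ∀ n : ℕ, ((n : ℝ) + 1) • (J n x - x) = J n (E x) := by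
    intro x n
    have h := (hR _ (hpos n)).left_inv x
    rw [map_sub, map_smul, Complex.coe_smul, sub_eq_iff_eq_add] at h
    simp only [hJ, smul_apply]
    rw [h, add_sub_cancel_left]
  have hJlim : ∀ y : H, Tendsto (fun n => J n y) atTop (𝓝 y) := by
    have hdomlim : ∀ x : E.domain, Tendsto (fun n => J n x - x) atTop (𝓝 0) := by
      intro x
      have h0 : Tendsto (fun n : ℕ => (1 / ((n : ℝ) + 1)) * (M * ‖E x‖)) atTop (𝓝 (0 * (M * ‖E x‖))) :=
        tendsto_one_div_add_atTop_nhds_zero_nat.mul_const _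
      rw [zero_mul] at h0
      refine squeeze_zero_norm (fun n => ?_) h0
      have h1 := congrArg norm (hJdom x n)
      rw [norm_smul, Real.norm_of_nonneg (hpos n).le] at h1
      rw [one_div_mul_eq_div, le_div_iff₀ (hpos n), mul_comm, h1]
      exact hJM n _
    intro y
    rw [Metric.tendsto_atTop]
    intro ε hε
    obtain ⟨x, hx, hxy⟩ := hE.exists_dist_lt y (ε := ε / (2 * (M + 1))) (by positivity)
    rw [dist_eq_norm, lt_div_iff₀ (by positivity)] at hxy
    obtain ⟨N, hN⟩ := Metric.tendsto_atTop.1 (hdomlim ⟨x, hx⟩) (ε / 2) (half_pos hε)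
    refine ⟨N, fun n hn => ?_⟩
    have h1 := norm_apply_sub_le_add (hJM n) y x
    have h2 := hN n hn
    rw [dist_zero_right] at h2
    rw [dist_eq_norm]
    simp only at h2
    linarith
  set A : ℕ → H →L[ℂ] H := fun n => ((n : ℝ) + 1) • (J n - 1) with hAdef
  have hcomm : ∀ m n, Commute (A m) (A n) := fun m n => by
    refine Commute.smul_left (Commute.smul_right ?_ _) _
    exact ((hcJ m n).sub_right (Commute.one_right _)).sub_left (Commute.one_left _)
  have hAlim : ∀ x : E.domain, Tendsto (fun n => A n x) atTop (𝓝 (E x)) := fun x => by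
    refine (hJlim (E x)).congr fun n => ?_
    rw [← hJdom]; rfl
  have hA : ∀ n (t : ℝ), 0 ≤ t → ∀ x, ‖exp (t • A n) x‖ ≤ M * ‖x‖ := by
    intro n t ht x
    set r : ℝ := t * ((n : ℝ) + 1) with hr
    have hr0 : 0 ≤ r := mul_nonneg ht (hpos n).le
    -- The scalar factor `e^{-r}` cancels the growth `e^r` that the power bounds on `J n` allow for
    -- `e^{r J n}`.
    have e : t • A n = r • J n + (-r) • (1 : H →L[ℂ] H) := by
      rw [hAdef, smul_smul, smul_sub, neg_smul, sub_eq_add_neg]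
    have hone : exp ((-r) • (1 : H →L[ℂ] H)) x = Real.exp (-r) • x := by
      have h1 : ∀ (k : ℕ) y, ((1 : H →L[ℂ] H) ^ k) y = y := by simp
      have h2 := algebraMap_exp_comm (𝕂 := ℝ) (𝔸 := H →L[ℂ] H) (-r)
      rw [Algebra.algebraMap_eq_smul_one, Algebra.algebraMap_eq_smul_one,
        ← Real.exp_eq_exp_ℝ] at h2
      rw [← h2]; rfl
    rw [e, exp_add_eq_mul_of_commute ((Commute.one_right _).smul_right _),
      mul_apply_eq_comp, hone,
      ContinuousLinearMap.map_smul_of_tower, norm_smul, Real.norm_of_nonneg (Real.exp_nonneg _)]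
    have h := norm_exp_smul_apply_le_of_norm_pow_le (hRM _ (hpos n)) hr0 x
    calc Real.exp (-r) * ‖exp (r • J n) x‖ ≤ Real.exp (-r) * (Real.exp r * (M * ‖x‖)) := by gcongr
      _ = M * ‖x‖ := by rw [← mul_assoc, ← Real.exp_add]; simp
  obtain ⟨T, hT, hTM, hTE⟩ := exists_isC0Semigroup_of_tendsto hE hM hcomm hA hAlim
  exact ⟨T, hT, hT.isGeneratorOf_of_resolvent hTM hTE (z := ((1 : ℝ) : ℂ)) (by simp)
    (hR 1 one_pos), hTM⟩

end HilleYosida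

/-! ### Positive operators as ultrafilter limits of Gram forms -/

section UltrafilterForm

variable {H : Type u} [NormedAddCommGroup H] [InnerProductSpace ℂ H]
variable {K : Type*} [NormedAddCommGroup K]
variable {X : Type*} [MeasurableSpace X]

theorem eLpNorm_two_pow_two_eq_lintegral {μ : Measure X} (f : X → K) :
    eLpNorm f 2 μ ^ 2 = ∫⁻ a, ‖f a‖ₑ ^ 2 ∂μ := by
  have h := eLpNorm_nnreal_pow_eq_lintegral (μ := μ) (f := f) (p := 2) two_ne_zero
  simpa using h

theorem toReal_eLpNorm_two_le {μ : Measure X} {f : X → K} {c : ℝ} (hc : 0 ≤ c)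
    (h : ∫⁻ a, ‖f a‖ₑ ^ 2 ∂μ ≤ ENNReal.ofReal (c ^ 2)) : (eLpNorm f 2 μ).toReal ≤ c := by
  rw [← eLpNorm_two_pow_two_eq_lintegral, ENNReal.ofReal_pow hc,
    ENNReal.pow_le_pow_left_iff two_ne_zero] at h
  exact ENNReal.toReal_le_of_le_ofReal hc h

theorem memLp_two_of_lintegral_lt_top {μ : Measure X} {f : X → K} (hf : AEStronglyMeasurable f μ)
    (h : ∫⁻ a, ‖f a‖ₑ ^ 2 ∂μ < ⊤) : MemLp f 2 μ := by
  refine ⟨hf, ?_⟩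
  rw [← eLpNorm_two_pow_two_eq_lintegral] at h
  exact (ENNReal.pow_lt_top_iff.1 h).resolve_right two_ne_zero

variable [InnerProductSpace ℂ K]

theorem MeasureTheory.MemLp.integrable_inner {μ : Measure X} {f g : X → K} (hf : MemLp f 2 μ)
    (hg : MemLp g 2 μ) : Integrable (fun a => inner ℂ (f a) (g a)) μ := by
  refine (L2.integrable_inner (𝕜 := ℂ) (hf.toLp f) (hg.toLp g)).congr ?_
  filter_upwards [hf.coeFn_toLp, hg.coeFn_toLp] with a ha hb
  rw [ha, hb]

theorem MeasureTheory.MemLp.norm_integral_inner_le {μ : Measure X} {f g : X → K}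
    (hf : MemLp f 2 μ) (hg : MemLp g 2 μ) :
    ‖∫ a, inner ℂ (f a) (g a) ∂μ‖ ≤ (eLpNorm f 2 μ).toReal * (eLpNorm g 2 μ).toReal := by
  have e : ∫ a, inner ℂ (f a) (g a) ∂μ = inner ℂ (hf.toLp f) (hg.toLp g) := by
    rw [L2.inner_def]
    refine integral_congr_ae ?_
    filter_upwards [hf.coeFn_toLp, hg.coeFn_toLp] with a ha hb
    rw [ha, hb]
  rw [e, ← Lp.norm_toLp f hf, ← Lp.norm_toLp g hg]
  exact norm_inner_le_norm _ _

theorem MeasureTheory.MemLp.integral_inner_self {μ : Measure X} {f : X → K} (hf : MemLp f 2 μ) :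
    ∫ a, inner ℂ (f a) (f a) ∂μ = (((∫⁻ a, ‖f a‖ₑ ^ 2 ∂μ).toReal : ℝ) : ℂ) := by
  have hf2 : Integrable (fun a => ‖f a‖ ^ 2) μ := (memLp_two_iff_integrable_sq_norm hf.1).1 hf
  have e : ∀ a, inner ℂ (f a) (f a) = ((‖f a‖ ^ 2 : ℝ) : ℂ) := fun a => by
    rw [inner_self_eq_norm_sq_to_K]; simp
  simp_rw [e]
  rw [integral_complex_ofReal, integral_eq_lintegral_of_nonneg_ae
    (Eventually.of_forall fun a => by positivity) hf2.1]
  congr 3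
  ext a
  rw [ENNReal.ofReal_pow (norm_nonneg _), ofReal_norm]

variable [CompleteSpace H]

/-- For fixed `x` and `y` the values eventually lie in a compact disc, so they converge along `𝒰`;
the limit is a bounded sesquilinear form, represented by an operator. The algebraic laws are
required only eventually, because additivity of a Gram integral needs square integrability, which
itself holds only eventually. -/
theorem Ultrafilter.exists_clm_tendsto_inner {ι : Type*} (𝒰 : Ultrafilter ι) {b : ι → H → H → ℂ}
    {M : ℝ} (add_left : ∀ x y z, ∀ᶠ i in (𝒰 : Filter ι), b i (x + y) z = b i x z + b i y z)
    (smul_left : ∀ (c : ℂ) x z, ∀ᶠ i in (𝒰 : Filter ι), b i (c • x) z = starRingEnd ℂ c * b i x z)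
    (add_right : ∀ x y z, ∀ᶠ i in (𝒰 : Filter ι), b i x (y + z) = b i x y + b i x z)
    (smul_right : ∀ (c : ℂ) x z, ∀ᶠ i in (𝒰 : Filter ι), b i x (c • z) = c * b i x z)
    (bound : ∀ x y, ∀ᶠ i in (𝒰 : Filter ι), ‖b i x y‖ ≤ M * ‖x‖ * ‖y‖) :
    ∃ Q : H →L[ℂ] H, ∀ x y, Tendsto (fun i => b i x y) 𝒰 (𝓝 (inner ℂ (Q x) y)) := by
  have hex : ∀ x y, ∃ z : ℂ, Tendsto (fun i => b i x y) 𝒰 (𝓝 z) := by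
    intro x y
    obtain ⟨z, -, hz⟩ := (isCompact_closedBall (0 : ℂ) (M * ‖x‖ * ‖y‖)).ultrafilter_le_nhds
      (𝒰.map fun i => b i x y) (by
        rw [le_principal_iff, Ultrafilter.mem_coe, Ultrafilter.mem_map]
        filter_upwards [bound x y] with i hi
        simpa using hi)
    exact ⟨z, hz⟩
  choose B hB using hex
  set L : H →ₗ⋆[ℂ] H →ₗ[ℂ] ℂ := LinearMap.mk₂'ₛₗ (starRingEnd ℂ) (RingHom.id ℂ) B
    (fun x y z => tendsto_nhds_unique_of_eventuallyEq (hB _ _) ((hB x z).add (hB y z))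
      (add_left x y z))
    (fun c x z => tendsto_nhds_unique_of_eventuallyEq (hB _ _) ((hB x z).const_mul _)
      (smul_left c x z))
    (fun x y z => tendsto_nhds_unique_of_eventuallyEq (hB _ _) ((hB x y).add (hB x z))
      (add_right x y z))
    (fun c x z => tendsto_nhds_unique_of_eventuallyEq (hB _ _) ((hB x z).const_mul _)
      (smul_right c x z)) with hL
  have hLb : ∀ x y, ‖L x y‖ ≤ M * ‖x‖ * ‖y‖ := fun x y => le_of_tendsto (hB x y).norm (bound x y)
  refine ⟨InnerProductSpace.continuousLinearMapOfBilin (L.mkContinuous₂ M hLb), fun x y => ?_⟩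
  rw [InnerProductSpace.continuousLinearMapOfBilin_apply]
  exact hB x y

/-- Along an ultrafilter, square-integrable linear families which are eventually bounded induce a
positive bounded operator as the limit of their Gram forms. -/
theorem Ultrafilter.exists_isPositive_tendsto {ι : Type*} (𝒰 : Ultrafilter ι) {μ : ι → Measure X}
    {F : ι → H → X → K} {M : ℝ} (hM : 0 ≤ M)
    (add : ∀ i x y a, F i (x + y) a = F i x a + F i y a)
    (smul : ∀ i (c : ℂ) x a, F i (c • x) a = c • F i x a)
    (meas : ∀ x, ∀ᶠ i in (𝒰 : Filter ι), AEStronglyMeasurable (F i x) (μ i))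
    (bound : ∀ x, ∀ᶠ i in (𝒰 : Filter ι),
      ∫⁻ a, ‖F i x a‖ₑ ^ 2 ∂(μ i) ≤ ENNReal.ofReal ((M * ‖x‖) ^ 2)) :
    ∃ Q : H →L[ℂ] H, Q.IsPositive ∧
      (∀ x y, Tendsto (fun i => ∫ a, inner ℂ (F i x a) (F i y a) ∂(μ i)) 𝒰
        (𝓝 (inner ℂ (Q x) y))) ∧
      ∀ x, Tendsto (fun i => (∫⁻ a, ‖F i x a‖ₑ ^ 2 ∂(μ i)).toReal) 𝒰
        (𝓝 (inner ℂ (Q x) x).re) := by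
  have hLp : ∀ x, ∀ᶠ i in (𝒰 : Filter ι), MemLp (F i x) 2 (μ i) := fun x => by
    filter_upwards [meas x, bound x] with i h1 h2
    exact memLp_two_of_lintegral_lt_top h1 (h2.trans_lt ENNReal.ofReal_lt_top)
  obtain ⟨Q, hQ⟩ := 𝒰.exists_clm_tendsto_inner
    (b := fun i x y => ∫ a, inner ℂ (F i x a) (F i y a) ∂(μ i)) (M := M * M)
    (fun x y z => by
      filter_upwards [hLp x, hLp y, hLp z] with i hx hy hz
      rw [← integral_add (hx.integrable_inner hz) (hy.integrable_inner hz)]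
      simp_rw [add, inner_add_left])
    (fun c x z => Eventually.of_forall fun i => by
      simp_rw [smul, inner_smul_left]
      exact integral_const_mul _ _)
    (fun x y z => by
      filter_upwards [hLp x, hLp y, hLp z] with i hx hy hz
      rw [← integral_add (hx.integrable_inner hy) (hx.integrable_inner hz)]
      simp_rw [add, inner_add_right])
    (fun c x z => Eventually.of_forall fun i => by
      simp_rw [smul, inner_smul_right]
      exact integral_const_mul _ _)
    (fun x y => by
      filter_upwards [hLp x, hLp y, bound x, bound y] with i hx hy hbx hby
      refine (hx.norm_integral_inner_le hy).trans ?_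
      calc _ ≤ (M * ‖x‖) * (M * ‖y‖) :=
            mul_le_mul (toReal_eLpNorm_two_le (by positivity) hbx)
              (toReal_eLpNorm_two_le (by positivity) hby) ENNReal.toReal_nonneg (by positivity)
        _ = M * M * ‖x‖ * ‖y‖ := by ring)
  have hself : ∀ x, Tendsto (fun i => (((∫⁻ a, ‖F i x a‖ₑ ^ 2 ∂(μ i)).toReal : ℝ) : ℂ)) 𝒰
      (𝓝 (inner ℂ (Q x) x)) := fun x => by
    refine (hQ x x).congr' ?_
    filter_upwards [hLp x] with i hx
    exact hx.integral_inner_self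
  have hre : ∀ x, Tendsto (fun i => (∫⁻ a, ‖F i x a‖ₑ ^ 2 ∂(μ i)).toReal) 𝒰
      (𝓝 (inner ℂ (Q x) x).re) := fun x => by
    simpa [Function.comp_def] using (Complex.continuous_re.tendsto _).comp (hself x)
  refine ⟨Q, (ContinuousLinearMap.isPositive_iff_complex Q).2 fun x => ⟨?_, ?_⟩, hQ, hre⟩
  · refine tendsto_nhds_unique ?_ (hself x)
    exact (Complex.continuous_ofReal.tendsto _).comp (hre x)
  · exact ge_of_tendsto (hre x) (Eventually.of_forall fun i => ENNReal.toReal_nonneg)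

theorem ContinuousLinearMap.isUnit_of_le_re_inner {Q : H →L[ℂ] H} {m : ℝ}
    (hm : 0 < m) (h : ∀ x, m * ‖x‖ ^ 2 ≤ (inner ℂ (Q x) x).re) : IsUnit Q := by
  refine Q.isUnit_of_forall_le_norm_inner_map (c := ⟨m, hm.le⟩) (by exact_mod_cast hm) fun x => ?_
  calc ‖x‖ ^ 2 * m = m * ‖x‖ ^ 2 := mul_comm _ _
    _ ≤ _ := h x
    _ ≤ _ := Complex.re_le_norm _

/-- Take `W = √Q`, which is self-adjoint, and invertible because `Q` is. -/
theorem ContinuousLinearMap.IsPositive.exists_equiv_norm_sq_eq {Q : H →L[ℂ] H} (hQ : Q.IsPositive)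
    (hU : IsUnit Q) : ∃ W : H ≃L[ℂ] H, ∀ x, ‖W x‖ ^ 2 = (inner ℂ (Q x) x).re := by
  have hQ0 : 0 ≤ Q := (ContinuousLinearMap.nonneg_iff_isPositive Q).2 hQ
  obtain ⟨w, hw⟩ := (CFC.isUnit_sqrt_iff Q hQ0).2 hU
  refine ⟨ContinuousLinearEquiv.ofUnit w, fun x => ?_⟩
  have hW : ∀ y, ContinuousLinearEquiv.ofUnit w y = CFC.sqrt Q y := fun y => by rw [← hw]; rfl
  have hsymm : (CFC.sqrt Q).IsSymmetric :=
    ((ContinuousLinearMap.nonneg_iff_isPositive _).1 (CFC.sqrt_nonneg Q)).isSymmetric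
  have e : Q x = CFC.sqrt Q (CFC.sqrt Q x) := by
    conv_lhs => rw [← CFC.sqrt_mul_sqrt_self Q hQ0]
    rfl
  rw [hW, e]
  have := hsymm (CFC.sqrt Q x) x
  rw [ContinuousLinearMap.coe_coe] at this
  rw [this, ← inner_self_eq_norm_sq (𝕜 := ℂ)]
  rfl

end UltrafilterForm

/-! ### Weighted Cesàro means bound the semigroup -/

section CesaroMeans

theorem setLIntegral_Icc_comp_add_right (f : ℝ → ENNReal) (τ t : ℝ) :
    ∫⁻ s in Set.Icc 0 t, f (s + τ) = ∫⁻ s in Set.Icc τ (t + τ), f s := by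
  have h := (measurePreserving_add_right volume τ).setLIntegral_comp_preimage_emb
    (measurableEmbedding_addRight τ) f (Set.Icc τ (t + τ))
  simpa using h

theorem setLIntegral_Icc_le_add (f : ℝ → ENNReal) (a b c : ℝ) :
    ∫⁻ s in Set.Icc a c, f s ≤ (∫⁻ s in Set.Icc a b, f s) + ∫⁻ s in Set.Icc b c, f s := by
  refine (lintegral_mono_set fun s hs => ?_).trans (lintegral_union_le f _ _)
  rcases le_total s b with h | h
  · exact Or.inl ⟨hs.1, h⟩
  · exact Or.inr ⟨h, hs.2⟩

variable {H : Type u} [NormedAddCommGroup H] [InnerProductSpace ℂ H]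
variable {K : Type u} [NormedAddCommGroup K] [InnerProductSpace ℂ K]
variable {T : ℝ → H →L[ℂ] H} {C : H →ₗ.[ℂ] K}

theorem setLIntegral_orbit_shift (hT : IsC0Semigroup T) (f : H → ENNReal) (h : H) {τ : ℝ}
    (hτ : 0 ≤ τ) (t : ℝ) :
    ∫⁻ s in Set.Icc 0 t, f (T s (T τ h)) = ∫⁻ s in Set.Icc τ (t + τ), f (T s h) := by
  rw [← setLIntegral_Icc_comp_add_right (fun s => f (T s h))]
  refine setLIntegral_congr_fun measurableSet_Icc fun s hs => ?_
  simp only [hT.apply_add hs.1 hτ]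

/-- The window `[τ, t + τ]` lies in `[0, t + τ]`, and `1/t ≤ 2/(t + τ)` once `t ≥ τ`. The crude
factor `2` does not depend on `τ`, which is all that uniform boundedness needs. -/
theorem cesaroMean_orbit_le (hT : IsC0Semigroup T) (h : H) {τ : ℝ} (hτ : 0 ≤ τ) :
    ∀ᶠ t in atTop, cesaroMean C T (T τ h) t ≤ 2 * cesaroMean C T h (t + τ) := by
  filter_upwards [eventually_ge_atTop τ, eventually_gt_atTop 0] with t ht ht0
  rw [cesaroMean, cesaroMean, ← mul_assoc,
    setLIntegral_orbit_shift hT (fun x => ‖applyOp C x‖ₑ ^ 2) h hτ]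
  refine mul_le_mul' ?_ (lintegral_mono_set (Set.Icc_subset_Icc_left hτ))
  rw [← ENNReal.ofReal_ofNat 2, ← ENNReal.ofReal_mul (by norm_num)]
  refine ENNReal.ofReal_le_ofReal ?_
  rw [mul_one_div, div_le_div_iff₀ ht0 (by linarith)]
  linarith

/-- The initial piece over `[0, τ]` has finite integral, so its share of the mean vanishes as `t →
∞`. -/
theorem cesaroMean_le_orbit (hT : IsC0Semigroup T) (h : H) {τ : ℝ} (hτ : 0 ≤ τ)
    (hfin : ∫⁻ s in Set.Icc 0 τ, ‖applyOp C (T s h)‖ₑ ^ 2 ≠ ⊤) {δ : ENNReal} (hδ : δ ≠ 0) :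
    ∀ᶠ t in atTop, cesaroMean C T h (t + τ) ≤ δ + cesaroMean C T (T τ h) t := by
  have hlim : Tendsto (fun t : ℝ => ENNReal.ofReal (1 / (t + τ)) *
      ∫⁻ s in Set.Icc 0 τ, ‖applyOp C (T s h)‖ₑ ^ 2) atTop (𝓝 0) := by
    have h1 : Tendsto (fun t : ℝ => 1 / (t + τ)) atTop (𝓝 0) :=
      tendsto_const_nhds.div_atTop (tendsto_atTop_add_const_right _ τ tendsto_id)
    have h2 := ENNReal.Tendsto.mul_const (ENNReal.tendsto_ofReal h1) (Or.inr hfin)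
    simpa using h2
  filter_upwards [hlim.eventually_le_const (pos_iff_ne_zero.2 hδ), eventually_gt_atTop 0]
    with t ht ht0
  rw [cesaroMean, cesaroMean, setLIntegral_orbit_shift hT (fun x => ‖applyOp C x‖ₑ ^ 2) h hτ]
  refine (mul_le_mul_right (setLIntegral_Icc_le_add _ 0 τ (t + τ)) _).trans ?_
  rw [mul_add]
  refine add_le_add ht (mul_le_mul_left (ENNReal.ofReal_le_ofReal ?_) _)
  exact one_div_le_one_div_of_le ht0 (by linarith)

theorem setLIntegral_ne_top_of_liminf_cesaroMean_ne_top {h : H}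
    (hfin : liminf (cesaroMean C T h) atTop ≠ ⊤) (τ : ℝ) :
    ∫⁻ s in Set.Icc 0 τ, ‖applyOp C (T s h)‖ₑ ^ 2 ≠ ⊤ := by
  obtain ⟨t, ht, ht0, hτ⟩ := ((frequently_lt_of_liminf_lt (by isBoundedDefault)
    (lt_top_iff_ne_top.2 hfin)).and_eventually
      ((eventually_gt_atTop 0).and (eventually_ge_atTop τ))).exists
  rw [cesaroMean] at ht
  have h1 : ∫⁻ s in Set.Icc 0 t, ‖applyOp C (T s h)‖ₑ ^ 2 ≠ ⊤ := by
    intro htop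
    rw [htop, ENNReal.mul_top] at ht
    · exact lt_irrefl _ ht
    · simpa using ht0
  exact ne_top_of_le_ne_top h1 (lintegral_mono_set (Set.Icc_subset_Icc_right hτ))

/-- Bounds on a generalized limit `Φ` of the weighted Cesàro means bound the semigroup from above
and from below. -/
theorem IsSemigroupWeight.norm_sq_bounds (hT : IsC0Semigroup T) (hC : IsSemigroupWeight C T)
    (Φ : (ℝ → ENNReal) → ENNReal) (mono : ∀ u v, u ≤ᶠ[atTop] v → Φ u ≤ Φ v)
    (shift : ∀ v (τ : ℝ), Φ (fun t => v (t + τ)) = Φ v)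
    (affine : ∀ (a b : ENNReal) v, a ≠ ⊤ → b ≠ ⊤ → Φ (fun t => a + b * v t) = a + b * Φ v)
    (liminf_le : ∀ v, liminf v atTop ≤ Φ v) {α β : ℝ} (hα : 0 < α) (hβ : 0 < β)
    (hΦ : ∀ h ∈ C.domain, ENNReal.ofReal (α * ‖h‖ ^ 2) ≤ Φ (cesaroMean C T h) ∧
      Φ (cesaroMean C T h) ≤ ENNReal.ofReal (β * ‖h‖ ^ 2)) {t : ℝ} (ht : 0 ≤ t) (h : H) :
    α / β * ‖h‖ ^ 2 ≤ ‖T t h‖ ^ 2 ∧ ‖T t h‖ ^ 2 ≤ 2 * β / α * ‖h‖ ^ 2 := by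
  -- The means are controlled only on `dom C`; both inequalities are closed conditions on `h`, so
  -- the dense domain suffices.
  have hcl : IsClosed {h : H | α / β * ‖h‖ ^ 2 ≤ ‖T t h‖ ^ 2 ∧ ‖T t h‖ ^ 2 ≤ 2 * β / α * ‖h‖ ^ 2} :=
    IsClosed.and (isClosed_le (by fun_prop) (by fun_prop)) (isClosed_le (by fun_prop) (by fun_prop))
  refine isClosed_property (p := fun h => α / β * ‖h‖ ^ 2 ≤ ‖T t h‖ ^ 2 ∧
    ‖T t h‖ ^ 2 ≤ 2 * β / α * ‖h‖ ^ 2) hC.dense.denseRange_val hcl (fun x => ?_) h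
  obtain ⟨x, hx⟩ := x
  obtain ⟨hl, hu⟩ := hΦ x hx
  obtain ⟨hl', hu'⟩ := hΦ (T t x) (hC.invariant t ht x hx)
  have hfin := setLIntegral_ne_top_of_liminf_cesaroMean_ne_top (C := C) (T := T) (h := x)
    (ne_top_of_le_ne_top ENNReal.ofReal_ne_top ((liminf_le _).trans hu)) t
  constructor
  · rw [div_mul_eq_mul_div, div_le_iff₀ hβ, mul_comm (‖T t x‖ ^ 2)]
    have key : ENNReal.ofReal (α * ‖x‖ ^ 2) ≤ ENNReal.ofReal (β * ‖T t x‖ ^ 2) := by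
      refine _root_.le_of_forall_pos_le_add fun δ hδ => ?_
      rcases eq_or_ne δ ⊤ with rfl | hδ'
      · simp
      have h1 := mono _ _ (cesaroMean_le_orbit hT x ht hfin hδ.ne')
      rw [shift (cesaroMean C T x) t] at h1
      have h2 := affine δ 1 (cesaroMean C T (T t x)) hδ' ENNReal.one_ne_top
      simp only [one_mul] at h2
      rw [h2] at h1
      rw [add_comm]
      exact hl.trans (h1.trans (by gcongr))
    exact (ENNReal.ofReal_le_ofReal_iff (by positivity)).1 key
  · rw [div_mul_eq_mul_div, le_div_iff₀ hα, mul_comm (‖T t x‖ ^ 2), mul_assoc]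
    have h1 := mono _ _ (cesaroMean_orbit_le (C := C) hT x ht)
    have h2 := affine 0 2 (fun s => cesaroMean C T x (s + t)) ENNReal.zero_ne_top ENNReal.ofNat_ne_top
    simp only [zero_add] at h2
    rw [h2, shift (cesaroMean C T x) t] at h1
    have key : ENNReal.ofReal (α * ‖T t x‖ ^ 2) ≤ ENNReal.ofReal (2 * (β * ‖x‖ ^ 2)) := by
      rw [ENNReal.ofReal_mul (p := 2) (by norm_num), ENNReal.ofReal_ofNat]
      exact hl'.trans (h1.trans (by gcongr))
    exact (ENNReal.ofReal_le_ofReal_iff (by positivity)).1 key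

theorem map_add_right_atTop (τ : ℝ) : map (fun t : ℝ => t + τ) atTop = atTop :=
  (OrderIso.addRight τ).map_atTop

theorem monotone_add_const_mul (a b : ENNReal) : Monotone fun x : ENNReal => a + b * x :=
  fun _ _ h => add_le_add_right (mul_le_mul_right h b) a

theorem continuous_add_const_mul (a : ENNReal) {b : ENNReal} (hb : b ≠ ⊤) :
    Continuous fun x : ENNReal => a + b * x :=
  continuous_const.add (ENNReal.continuous_const_mul hb)

theorem IsSemigroupWeight.norm_sq_bounds_of_limsup (hT : IsC0Semigroup T)
    (hC : IsSemigroupWeight C T) {α β : ℝ} (hα : 0 < α) (hβ : 0 < β)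
    (hΦ : ∀ h ∈ C.domain, ENNReal.ofReal (α * ‖h‖ ^ 2) ≤ limsup (cesaroMean C T h) atTop ∧
      limsup (cesaroMean C T h) atTop ≤ ENNReal.ofReal (β * ‖h‖ ^ 2)) {t : ℝ} (ht : 0 ≤ t) (h : H) :
    α / β * ‖h‖ ^ 2 ≤ ‖T t h‖ ^ 2 ∧ ‖T t h‖ ^ 2 ≤ 2 * β / α * ‖h‖ ^ 2 :=
  hC.norm_sq_bounds hT (fun v => limsup v atTop) (fun _ _ huv => limsup_le_limsup huv)
    (fun v τ => by
      conv_rhs => rw [← map_add_right_atTop τ]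
      rfl)
    (fun a _ v _ hb => ((monotone_add_const_mul a _).map_limsup_of_continuousAt v
      (continuous_add_const_mul a hb).continuousAt).symm)
    (fun _ => liminf_le_limsup) hα hβ hΦ ht h

theorem IsSemigroupWeight.norm_sq_bounds_of_liminf (hT : IsC0Semigroup T)
    (hC : IsSemigroupWeight C T) {α β : ℝ} (hα : 0 < α) (hβ : 0 < β)
    (hΦ : ∀ h ∈ C.domain, ENNReal.ofReal (α * ‖h‖ ^ 2) ≤ liminf (cesaroMean C T h) atTop ∧
      liminf (cesaroMean C T h) atTop ≤ ENNReal.ofReal (β * ‖h‖ ^ 2)) {t : ℝ} (ht : 0 ≤ t) (h : H) :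
    α / β * ‖h‖ ^ 2 ≤ ‖T t h‖ ^ 2 ∧ ‖T t h‖ ^ 2 ≤ 2 * β / α * ‖h‖ ^ 2 :=
  hC.norm_sq_bounds hT (fun v => liminf v atTop) (fun _ _ huv => liminf_le_liminf huv)
    (fun v τ => by
      conv_rhs => rw [← map_add_right_atTop τ]
      rfl)
    (fun a _ v _ hb => ((monotone_add_const_mul a _).map_liminf_of_continuousAt v
      (continuous_add_const_mul a hb).continuousAt).symm)
    (fun _ => le_rfl) hα hβ hΦ ht h

end CesaroMeans

/-! ### The identity weight; similarity from two-sided bounds -/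

section IdentityWeight

variable {H : Type u} [NormedAddCommGroup H] [InnerProductSpace ℂ H]

/-- The identity as an everywhere defined operator. -/
noncomputable def idPMap (H : Type u) [NormedAddCommGroup H] [InnerProductSpace ℂ H] : H →ₗ.[ℂ] H :=
  (LinearMap.id : H →ₗ[ℂ] H).toPMap ⊤

theorem idPMap_domain : (idPMap H).domain = ⊤ := rfl

@[simp]
theorem applyOp_idPMap (x : H) : applyOp (idPMap H) x = x := by
  rw [applyOp, dif_pos (show x ∈ (idPMap H).domain from Submodule.mem_top)]
  rfl

theorem cesaroMean_idPMap (T : ℝ → H →L[ℂ] H) (h : H) (t : ℝ) :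
    cesaroMean (idPMap H) T h t = ENNReal.ofReal (1 / t) * ∫⁻ s in Set.Icc 0 t, ‖T s h‖ₑ ^ 2 := by
  simp_rw [cesaroMean, applyOp_idPMap]

theorem one_div_mul_setLIntegral_const {t : ℝ} (ht : 0 < t) (c : ENNReal) :
    ENNReal.ofReal (1 / t) * ∫⁻ _ in Set.Icc 0 t, c = c := by
  rw [setLIntegral_const, Real.volume_Icc, sub_zero, mul_comm c, ← mul_assoc,
    ← ENNReal.ofReal_mul (by positivity), one_div_mul_cancel ht.ne', ENNReal.ofReal_one, one_mul]

theorem enorm_sq_le_ofReal {E : Type*} [NormedAddCommGroup E] {x : E} {c : ℝ} (h : ‖x‖ ^ 2 ≤ c) :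
    ‖x‖ₑ ^ 2 ≤ ENNReal.ofReal c := by
  rw [← ofReal_norm, ← ENNReal.ofReal_pow (norm_nonneg _)]
  exact ENNReal.ofReal_le_ofReal h

theorem ofReal_le_enorm_sq {E : Type*} [NormedAddCommGroup E] {x : E} {c : ℝ} (h : c ≤ ‖x‖ ^ 2) :
    ENNReal.ofReal c ≤ ‖x‖ₑ ^ 2 := by
  rw [← ofReal_norm, ← ENNReal.ofReal_pow (norm_nonneg _)]
  exact ENNReal.ofReal_le_ofReal h

theorem norm_le_sqrt_mul {E : Type*} [NormedAddCommGroup E] {M : ℝ} {x y : E} (h : ‖y‖ ^ 2 ≤ M * ‖x‖ ^ 2) : ‖y‖ ≤ √M * ‖x‖ := by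
  rw [← Real.sqrt_sq (norm_nonneg y), ← Real.sqrt_sq (norm_nonneg x),
    ← Real.sqrt_mul' _ (sq_nonneg _)]
  exact Real.sqrt_le_sqrt h

variable {T : ℝ → H →L[ℂ] H} {m M : ℝ}

theorem cesaroMean_idPMap_le (h : H) (hM : ∀ t : ℝ, 0 ≤ t → ‖T t h‖ ^ 2 ≤ M * ‖h‖ ^ 2) {t : ℝ}
    (ht : 0 < t) : cesaroMean (idPMap H) T h t ≤ ENNReal.ofReal (M * ‖h‖ ^ 2) := by
  rw [cesaroMean_idPMap, ← one_div_mul_setLIntegral_const ht (ENNReal.ofReal (M * ‖h‖ ^ 2))]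
  exact mul_le_mul_right (setLIntegral_mono' measurableSet_Icc fun s hs =>
    enorm_sq_le_ofReal (hM s hs.1)) _

theorem le_cesaroMean_idPMap (h : H) (hm : ∀ t : ℝ, 0 ≤ t → m * ‖h‖ ^ 2 ≤ ‖T t h‖ ^ 2) {t : ℝ}
    (ht : 0 < t) : ENNReal.ofReal (m * ‖h‖ ^ 2) ≤ cesaroMean (idPMap H) T h t := by
  rw [cesaroMean_idPMap, ← one_div_mul_setLIntegral_const ht (ENNReal.ofReal (m * ‖h‖ ^ 2))]
  exact mul_le_mul_right (setLIntegral_mono' measurableSet_Icc fun s hs =>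
    ofReal_le_enorm_sq (hm s hs.1)) _

theorem IsC0Semigroup.isSemigroupWeight_idPMap (hT : IsC0Semigroup T)
    (hM : ∀ t : ℝ, 0 ≤ t → ∀ h, ‖T t h‖ ≤ M * ‖h‖) : IsSemigroupWeight (idPMap H) T where
  dense := by rw [idPMap_domain]; exact dense_univ
  invariant _ _ _ _ := Submodule.mem_top
  measurable h _ := by
    simp_rw [applyOp_idPMap]
    exact (hT.continuousOn_orbit hM h).aestronglyMeasurable measurableSet_Ici

theorem setLIntegral_orbit_norm_sq_le (h : H)
    (hM : ∀ t : ℝ, 0 ≤ t → ‖T t h‖ ^ 2 ≤ M * ‖h‖ ^ 2) {a t : ℝ} (ha : 0 ≤ a) (ht : 0 ≤ t) :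
    ∫⁻ s in Set.Icc a (a + t), ‖T s h‖ₑ ^ 2 ≤ ENNReal.ofReal (t * (M * ‖h‖ ^ 2)) := by
  refine (setLIntegral_mono' measurableSet_Icc fun s hs =>
    enorm_sq_le_ofReal (hM s (ha.trans hs.1))).trans ?_
  rw [setLIntegral_const, Real.volume_Icc, add_sub_cancel_left, mul_comm, ENNReal.ofReal_mul ht]

/-- The windows `[0, t]` and `[τ, t + τ]` differ by pieces of length at most `τ`, on which the
integrand is bounded, so the means differ by `O(1/t)`. Any ultrafilter limit is therefore exactly
invariant. -/
theorem IsC0Semigroup.tendsto_cesaroMean_orbit_sub (hT : IsC0Semigroup T) (h : H)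
    (hM : ∀ t : ℝ, 0 ≤ t → ‖T t h‖ ^ 2 ≤ M * ‖h‖ ^ 2) {τ : ℝ} (hτ : 0 ≤ τ) :
    Tendsto (fun t => (cesaroMean (idPMap H) T (T τ h) t).toReal
      - (cesaroMean (idPMap H) T h t).toReal) atTop (𝓝 0) := by
  set c : ℝ := τ * (M * ‖h‖ ^ 2) with hc
  have hM0 : 0 ≤ M * ‖h‖ ^ 2 := (sq_nonneg _).trans (hM 0 le_rfl)
  have hlim : Tendsto (fun t : ℝ => 1 / t * c) atTop (𝓝 0) := by
    have h1 : Tendsto (fun t : ℝ => 1 / t) atTop (𝓝 0) := tendsto_const_nhds.div_atTop tendsto_id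
    simpa using h1.mul_const c
  refine squeeze_zero_norm' ?_ hlim
  filter_upwards [eventually_gt_atTop 0] with t ht
  have hI : ∀ a t : ℝ, 0 ≤ a → 0 ≤ t → ∫⁻ s in Set.Icc a (a + t), ‖T s h‖ₑ ^ 2 ≠ ⊤ := fun a t ha ht =>
    ne_top_of_le_ne_top ENNReal.ofReal_ne_top (setLIntegral_orbit_norm_sq_le h hM ha ht)
  have h1 := setLIntegral_orbit_shift hT (fun x => ‖x‖ₑ ^ 2) h hτ t
  have h2 := setLIntegral_Icc_le_add (fun s => ‖T s h‖ₑ ^ 2) 0 τ t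
  have h3 := setLIntegral_Icc_le_add (fun s => ‖T s h‖ₑ ^ 2) τ t (t + τ)
  have h4 := setLIntegral_orbit_norm_sq_le h hM le_rfl hτ
  have h5 := setLIntegral_orbit_norm_sq_le h hM ht.le hτ
  have h6 : ∫⁻ s in Set.Icc τ t, ‖T s h‖ₑ ^ 2 ≤ ∫⁻ s in Set.Icc τ (t + τ), ‖T s h‖ₑ ^ 2 :=
    lintegral_mono_set (Set.Icc_subset_Icc_right (by linarith))
  have h7 : ∫⁻ s in Set.Icc τ t, ‖T s h‖ₑ ^ 2 ≤ ∫⁻ s in Set.Icc 0 t, ‖T s h‖ₑ ^ 2 :=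
    lintegral_mono_set (Set.Icc_subset_Icc_left hτ)
  have n0 := hI 0 t le_rfl ht.le
  have n1 := hI τ t hτ ht.le
  rw [zero_add] at h4 n0
  rw [add_comm τ t] at n1
  have k1 : (∫⁻ s in Set.Icc 0 t, ‖T s h‖ₑ ^ 2).toReal
      ≤ c + (∫⁻ s in Set.Icc τ (t + τ), ‖T s h‖ₑ ^ 2).toReal := by
    rw [← ENNReal.toReal_ofReal (r := c) (by positivity),
      ← ENNReal.toReal_add ENNReal.ofReal_ne_top n1]
    exact ENNReal.toReal_mono (ENNReal.add_ne_top.2 ⟨ENNReal.ofReal_ne_top, n1⟩)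
      (h2.trans (add_le_add h4 h6))
  have k2 : (∫⁻ s in Set.Icc τ (t + τ), ‖T s h‖ₑ ^ 2).toReal
      ≤ c + (∫⁻ s in Set.Icc 0 t, ‖T s h‖ₑ ^ 2).toReal := by
    rw [← ENNReal.toReal_ofReal (r := c) (by positivity),
      ← ENNReal.toReal_add ENNReal.ofReal_ne_top n0]
    refine ENNReal.toReal_mono (ENNReal.add_ne_top.2 ⟨ENNReal.ofReal_ne_top, n0⟩) ?_
    rw [add_comm (ENNReal.ofReal c)]
    exact h3.trans (add_le_add h7 h5)
  rw [cesaroMean_idPMap, cesaroMean_idPMap, h1, ENNReal.toReal_mul, ENNReal.toReal_mul,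
    ENNReal.toReal_ofReal (by positivity), ← mul_sub, norm_mul,
    Real.norm_of_nonneg (by positivity : 0 ≤ 1 / t)]
  refine mul_le_mul_of_nonneg_left ?_ (by positivity)
  rw [Real.norm_eq_abs, abs_le]
  constructor <;> linarith

/-- A semigroup on a Hilbert space which is bounded from above and from below is similar to a
semigroup of isometries. -/
theorem IsC0Semigroup.isSimilarToIsometricSemigroup [CompleteSpace H] (hT : IsC0Semigroup T)
    (hm0 : 0 < m) (hm : ∀ t : ℝ, 0 ≤ t → ∀ h, m * ‖h‖ ^ 2 ≤ ‖T t h‖ ^ 2)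
    (hM : ∀ t : ℝ, 0 ≤ t → ∀ h, ‖T t h‖ ^ 2 ≤ M * ‖h‖ ^ 2) : IsSimilarToIsometricSemigroup T := by
  have hM' : ∀ t : ℝ, 0 ≤ t → ∀ h, ‖T t h‖ ≤ √M * ‖h‖ := fun t ht h => norm_le_sqrt_mul (hM t ht h)
  set 𝒰 : Ultrafilter ℝ := Ultrafilter.of atTop
  have h𝒰 : (𝒰 : Filter ℝ) ≤ atTop := Ultrafilter.of_le atTop
  have hpos : ∀ᶠ t in (𝒰 : Filter ℝ), (0 : ℝ) < t := h𝒰 (eventually_gt_atTop 0)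
  have hmean : ∀ t h, ∫⁻ s, ‖T s h‖ₑ ^ 2 ∂(ENNReal.ofReal (1 / t) • volume.restrict (Set.Icc 0 t))
      = cesaroMean (idPMap H) T h t := fun t h => by
    rw [lintegral_smul_measure, cesaroMean_idPMap, smul_eq_mul]
  obtain ⟨Q, hQ, -, hQlim⟩ := 𝒰.exists_isPositive_tendsto
    (μ := fun t => ENNReal.ofReal (1 / t) • volume.restrict (Set.Icc 0 t))
    (F := fun _ h s => T s h) (M := √M) (Real.sqrt_nonneg _) (fun _ x y s => (T s).map_add x y)
    (fun _ c x s => (T s).map_smul c x)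
    (fun x => Eventually.of_forall fun t => (((hT.continuousOn_orbit hM' x).mono
      Set.Icc_subset_Ici_self).aestronglyMeasurable measurableSet_Icc).smul_measure _)
    (fun x => hpos.mono fun t ht => by
      rw [hmean, mul_pow]
      refine cesaroMean_idPMap_le x (fun s hs => ?_) ht
      rw [← mul_pow]
      exact pow_le_pow_left₀ (norm_nonneg _) (hM' s hs x) 2)
  simp_rw [hmean] at hQlim
  have hlow : ∀ x, m * ‖x‖ ^ 2 ≤ (inner ℂ (Q x) x).re := fun x => by
    refine ge_of_tendsto (hQlim x) (hpos.mono fun t ht => ?_)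
    rw [← ENNReal.ofReal_le_iff_le_toReal]
    · exact le_cesaroMean_idPMap x (fun s hs => hm s hs x) ht
    · exact ne_top_of_le_ne_top ENNReal.ofReal_ne_top
        (cesaroMean_idPMap_le x (fun s hs => hM s hs x) ht)
  have hinv : ∀ τ : ℝ, 0 ≤ τ → ∀ x, (inner ℂ (Q (T τ x)) (T τ x)).re = (inner ℂ (Q x) x).re := by
    intro τ hτ x
    have h1 := (hQlim (T τ x)).sub (hQlim x)
    have h2 := (hT.tendsto_cesaroMean_orbit_sub x (fun s hs => hM s hs x) hτ).mono_left h𝒰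
    exact sub_eq_zero.1 (tendsto_nhds_unique h1 h2)
  obtain ⟨W, hW⟩ := hQ.exists_equiv_norm_sq_eq
    (ContinuousLinearMap.isUnit_of_le_re_inner hm0 hlow)
  refine ⟨fun t => (W : H →L[ℂ] H).comp ((T t).comp (W.symm : H →L[ℂ] H)), W, ⟨?_, ?_, ?_⟩, ?_, ?_⟩
  · ext x; simp [hT.map_zero]
  · intro s t hs ht
    ext x; simp [hT.apply_add hs ht]
  · intro h
    have := (W.continuous.tendsto _).comp (hT.strongly_continuous (W.symm h))
    simpa [Function.comp_def] using this
  · intro t ht h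
    have : ‖W (T t (W.symm h))‖ ^ 2 = ‖h‖ ^ 2 := by
      rw [hW, hinv t ht, ← hW, W.apply_symm_apply]
    exact (sq_eq_sq₀ (norm_nonneg _) (norm_nonneg _)).1 this
  · intro t ht h
    rfl

end IdentityWeight

/-! ### Generation by operators skew for an equivalent inner product -/

section SkewSymmetric

variable {H : Type u} [NormedAddCommGroup H] [InnerProductSpace ℂ H]

theorem IsGeneratorOf.tendsto {E : H →ₗ.[ℂ] H} {T : ℝ → H →L[ℂ] H} (hE : IsGeneratorOf E T)
    (x : E.domain) :
    Tendsto (fun t : ℝ => ((t : ℂ)⁻¹) • (T t x - x)) (𝓝[>] 0) (𝓝 (E x)) :=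
  (hE x (E x)).1 (E.mem_graph x)

theorem IsGeneratorOf.orbit_mem {E : H →ₗ.[ℂ] H} {T : ℝ → H →L[ℂ] H} (hE : IsGeneratorOf E T)
    (hT : IsC0Semigroup T) (x : E.domain) {t : ℝ} (ht : 0 ≤ t) :
    ∃ y : E.domain, (y : H) = T t x ∧ E y = T t (E x) := by
  have h : (T t x, T t (E x)) ∈ E.graph := by
    rw [hE]
    refine (((T t).continuous.tendsto _).comp (hE.tendsto x)).congr' ?_
    filter_upwards [self_mem_nhdsWithin] with s hs
    have hs' : (0 : ℝ) ≤ s := le_of_lt hs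
    rw [Function.comp_apply, map_smul, map_sub, ← hT.apply_add ht hs', add_comm t s,
      hT.apply_add hs' ht]
  obtain ⟨y, h1, h2⟩ := (LinearPMap.mem_graph_iff E).1 h
  exact ⟨y, h1, h2⟩

variable {Q : H →L[ℂ] H} {E : H →ₗ.[ℂ] H} {m M : ℝ}

/-- If `E` is skew-symmetric for the form of `Q`, then the semigroup it generates is
isometric for that form. -/
theorem IsGeneratorOf.inner_orbit_eq (hQ : Q.IsPositive) {T : ℝ → H →L[ℂ] H}
    (hE : IsGeneratorOf E T) (hT : IsC0Semigroup T)
    (hM : ∀ t : ℝ, 0 ≤ t → ∀ h, ‖T t h‖ ≤ M * ‖h‖)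
    (skew : ∀ x : E.domain, (inner ℂ (Q (E x)) (x : H)).re = 0) (x : E.domain) {t : ℝ}
    (ht : 0 ≤ t) : (inner ℂ (Q (T t x)) (T t x)).re = (inner ℂ (Q x) (x : H)).re := by
  have hQs : ∀ a b : H, inner ℂ (Q a) b = inner ℂ a (Q b) := hQ.inner_left_eq_inner_right
  have hc := (hT.continuousOn_orbit hM x).mono (Set.Icc_subset_Ici_self : Set.Icc 0 t ⊆ Set.Ici 0)
  have hcont : ContinuousOn (fun s => inner ℂ (Q (T s x)) (T s x)) (Set.Icc 0 t) :=
    (Q.continuous.comp_continuousOn hc).inner hc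
  have key := constant_of_has_deriv_right_zero
    (f := fun s => (inner ℂ (Q (T s x)) (T s x)).re) (a := 0) (b := t)
    (Complex.continuous_re.comp_continuousOn hcont) (fun s hs => by
      have h1 := hT.hasDerivWithinAt_orbit (hE.tendsto x) hs.1
      have h2 : HasDerivWithinAt (fun s => Q (T s x)) (Q (T s (E x))) (Set.Ici s) s :=
        (Q.restrictScalars ℝ).hasFDerivAt.comp_hasDerivWithinAt s h1
      have h3 := Complex.reCLM.hasFDerivAt.comp_hasDerivWithinAt s (h2.inner ℂ h1)
      refine h3.congr_deriv ?_
      obtain ⟨y, hy, hy'⟩ := hE.orbit_mem hT x hs.1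
      have hsk : (inner ℂ (y : H) (Q (E y))).re = 0 := by
        rw [← inner_conj_symm, Complex.conj_re, skew]
      rw [← hy, ← hy', hQs (y : H)]
      simp [skew y, hsk])
    t ⟨ht, le_rfl⟩
  simpa [hT.map_zero] using key

/-- With `g = Ry`, write `y = rg - Eg`. As `r` is real, skewness kills the real cross terms, and
Pythagoras in the norm of `Q` gives the contraction property. -/
theorem inner_smul_resolvent_le (hQ : Q.IsPositive)
    (skew : ∀ x : E.domain, (inner ℂ (Q (E x)) (x : H)).re = 0) {r : ℝ} {R : H →L[ℂ] H}
    (hR : IsResolventAt E r R) (y : H) :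
    (inner ℂ (Q ((r • R) y)) ((r • R) y)).re ≤ (inner ℂ (Q y) y).re := by
  have hQs : ∀ a b : H, inner ℂ (Q a) b = inner ℂ a (Q b) := hQ.inner_left_eq_inner_right
  set g : E.domain := ⟨R y, hR.mem_domain y⟩
  have hE : E g = (r • R) y - y := by
    rw [hR.apply_eq]; simp
  have hy : y = (r • R) y - E g := by rw [hE]; abel
  have hg : (r • R) y = (r : ℂ) • (g : H) := by simp [g]
  have h0 : 0 ≤ (inner ℂ (Q (E g)) (E g)).re := hQ.re_inner_nonneg_left _
  have h1 : (inner ℂ (Q (E g)) ((r • R) y)).re = 0 := by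
    rw [hg, inner_smul_right, Complex.re_ofReal_mul, skew, mul_zero]
  have h2 : (inner ℂ (Q ((r • R) y)) (E g)).re = 0 := by
    rw [hQs, ← inner_conj_symm, Complex.conj_re, h1]
  conv_rhs => rw [hy]
  rw [map_sub, inner_sub_left, inner_sub_right, inner_sub_right, Complex.sub_re, Complex.sub_re,
    Complex.sub_re, h1, h2]
  linarith

variable [CompleteSpace H]

/-- If `v ⊥ dom E`, put `v = Qu` and `u = x - Ex`. Then `0 = Re⟨Qx, x - Ex⟩ = ⟨Qx, x⟩`, whence `x =
0` and `v = 0`. -/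
theorem dense_domain_of_skew (hQ : Q.IsPositive) (hm : 0 < m)
    (hQm : ∀ x, m * ‖x‖ ^ 2 ≤ (inner ℂ (Q x) x).re)
    (skew : ∀ x : E.domain, (inner ℂ (Q (E x)) (x : H)).re = 0) {R : H →L[ℂ] H}
    (hR : IsResolventAt E (1 : ℝ) R) : Dense (E.domain : Set H) := by
  have hQs : ∀ a b : H, inner ℂ (Q a) b = inner ℂ a (Q b) := hQ.inner_left_eq_inner_right
  rw [Submodule.dense_iff_topologicalClosure_eq_top, Submodule.topologicalClosure_eq_top_iff,
    Submodule.eq_bot_iff]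
  intro v hv
  obtain ⟨w, hw⟩ := ContinuousLinearMap.isUnit_of_le_re_inner hm hQm
  set u : H := (↑w⁻¹ : H →L[ℂ] H) v with hu
  have hQu : Q u = v := by
    rw [← hw, hu, ← mul_apply_eq_comp, Units.mul_inv, one_apply_eq_self]
  obtain ⟨hx, e⟩ := hR.right_inv u
  set x : E.domain := ⟨R u, hx⟩
  have hxu : u = (x : H) - E x := by
    rw [← e]; simp [x]
  have h1 : inner ℂ (Q (x : H)) u = 0 := by
    rw [hQs, hQu]
    exact (Submodule.mem_orthogonal _ v).1 hv x x.2
  have h2 := congrArg Complex.re h1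
  rw [hxu, inner_sub_right, Complex.sub_re, hQs (x : H) (E x), ← inner_conj_symm (x : H) (Q (E x)),
    Complex.conj_re, skew, sub_zero, Complex.zero_re] at h2
  have h3 : (x : H) = 0 := by
    have h4 := hQm x
    rw [h2] at h4
    have h5 : ‖(x : H)‖ ^ 2 ≤ 0 := by
      by_contra! h
      exact absurd h4 (not_le.2 (mul_pos hm h))
    simpa using h5
  have h4 : x = 0 := Subtype.ext h3
  rw [← hQu, hxu, h4]
  simp

/-- Contractivity in the norm of `Q` passes to powers, so in the original norm all powers of `r
R(r)` are bounded by `√(M/m)`, as Hille–Yosida demands. The semigroup preserves the form on `dom E`,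
hence everywhere by density. -/
theorem exists_isC0Semigroup_of_skew (hQ : Q.IsPositive) (hm : 0 < m) (hM : 0 < M)
    (hQm : ∀ x, m * ‖x‖ ^ 2 ≤ (inner ℂ (Q x) x).re)
    (hQM : ∀ x, (inner ℂ (Q x) x).re ≤ M * ‖x‖ ^ 2)
    (skew : ∀ x : E.domain, (inner ℂ (Q (E x)) (x : H)).re = 0) {R : ℝ → H →L[ℂ] H}
    (hR : ∀ r : ℝ, 0 < r → IsResolventAt E r (R r)) :
    ∃ T : ℝ → H →L[ℂ] H, IsC0Semigroup T ∧ IsGeneratorOf E T ∧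
      ∀ t : ℝ, 0 ≤ t → ∀ h, m / M * ‖h‖ ^ 2 ≤ ‖T t h‖ ^ 2 ∧ ‖T t h‖ ^ 2 ≤ M / m * ‖h‖ ^ 2 := by
  have hd := dense_domain_of_skew hQ hm hQm skew (hR 1 one_pos)
  have hbound : ∀ x y : H, (inner ℂ (Q y) y).re ≤ (inner ℂ (Q x) x).re →
      ‖y‖ ^ 2 ≤ M / m * ‖x‖ ^ 2 := fun x y h => by
    rw [div_mul_eq_mul_div, le_div_iff₀ hm, mul_comm]
    exact (hQm y).trans (h.trans (hQM x))
  have hpow : ∀ r : ℝ, 0 < r → ∀ (k : ℕ) x,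
      (inner ℂ (Q (((r • R r) ^ k) x)) (((r • R r) ^ k) x)).re ≤ (inner ℂ (Q x) x).re := by
    intro r hr k x
    induction k with
    | zero => simp
    | succ k ih =>
      rw [pow_succ', mul_apply_eq_comp]
      exact (inner_smul_resolvent_le hQ skew (hR r hr) _).trans ih
  obtain ⟨T, hT, hE, hTM⟩ := exists_isC0Semigroup_of_norm_resolvent_pow_le hd
    (Real.sqrt_nonneg (M / m)) hR
    (fun r hr k x => norm_le_sqrt_mul (hbound x _ (hpow r hr k x)))
  refine ⟨T, hT, hE, fun t ht h => ?_⟩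
  have hiso : (inner ℂ (Q (T t h)) (T t h)).re = (inner ℂ (Q h) h).re := by
    refine isClosed_property (p := fun h => (inner ℂ (Q (T t h)) (T t h)).re = (inner ℂ (Q h) h).re)
      hd.denseRange_val (isClosed_eq ?_ ?_) (fun x => ?_) h
    · exact Complex.continuous_re.comp (by fun_prop)
    · exact Complex.continuous_re.comp (by fun_prop)
    · exact hE.inner_orbit_eq hQ hT hTM skew x ht
  refine ⟨?_, hbound _ _ hiso.le⟩
  rw [div_mul_eq_mul_div, div_le_iff₀ hM, mul_comm (‖T t h‖ ^ 2)]
  exact (hQm h).trans (hiso.ge.trans (hQM _))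

end SkewSymmetric

/-! ### From weighted resolvent means to a skew generator -/

section ResolventMeans

theorem MeasureTheory.MemLp.integral_norm_sq {F X : Type*} [NormedAddCommGroup F] [MeasurableSpace X] {μ : Measure X}
    {f : X → F} (hf : MemLp f 2 μ) : ∫ a, ‖f a‖ ^ 2 ∂μ = (∫⁻ a, ‖f a‖ₑ ^ 2 ∂μ).toReal := by
  rw [integral_eq_lintegral_of_nonneg_ae (Eventually.of_forall fun a => by positivity)
    ((memLp_two_iff_integrable_sq_norm hf.1).1 hf).1]
  congr 2
  ext a
  rw [ENNReal.ofReal_pow (norm_nonneg _), ofReal_norm]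

variable {H : Type u} [NormedAddCommGroup H] [InnerProductSpace ℂ H]
variable {K : Type u} [NormedAddCommGroup K] [InnerProductSpace ℂ K]
variable {C : H →ₗ.[ℂ] K} {E : H →ₗ.[ℂ] H}

theorem applyOp_add {x y : H} (hx : x ∈ C.domain) (hy : y ∈ C.domain) :
    applyOp C (x + y) = applyOp C x + applyOp C y := by
  rw [applyOp, applyOp, applyOp, dif_pos hx, dif_pos hy, dif_pos (add_mem hx hy)]
  exact C.map_add ⟨x, hx⟩ ⟨y, hy⟩

theorem applyOp_smul (c : ℂ) {x : H} (hx : x ∈ C.domain) :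
    applyOp C (c • x) = c • applyOp C x := by
  rw [applyOp, applyOp, dif_pos hx, dif_pos (C.domain.smul_mem c hx)]
  exact C.map_smul c ⟨x, hx⟩

/-- The default value `0` is also in `dom E`, so `C` acts linearly on these vectors without any
hypothesis on `z`. -/
theorem operatorResolvent_mem_domain (z : ℂ) (h : H) : operatorResolvent E z h ∈ E.domain := by
  by_cases hz : z ∈ operatorResolventSet E
  · exact (isResolventAt_operatorResolvent hz).mem_domain h
  · rw [operatorResolvent, dif_neg (show ¬∃ R, IsResolventAt E z R from hz)]
    exact E.domain.zero_mem

/-- `C (ε + iξ - E)⁻¹ h`. -/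
noncomputable def weightedResolvent (C : H →ₗ.[ℂ] K) (E : H →ₗ.[ℂ] H) (ε : ℝ) (h : H) (ξ : ℝ) : K :=
  applyOp C (operatorResolvent E ((ε : ℂ) + (ξ : ℂ) * Complex.I) h)

theorem IsResolventWeight.resolvent_mem (hC : IsResolventWeight C E) (z : ℂ) (h : H) :
    operatorResolvent E z h ∈ C.domain := hC.domain_le (operatorResolvent_mem_domain z h)

theorem IsResolventWeight.weightedResolvent_add (hC : IsResolventWeight C E) (ε : ℝ) (x y : H)
    (ξ : ℝ) : weightedResolvent C E ε (x + y) ξ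
      = weightedResolvent C E ε x ξ + weightedResolvent C E ε y ξ := by
  rw [weightedResolvent, map_add, applyOp_add (hC.resolvent_mem _ _) (hC.resolvent_mem _ _)]
  rfl

theorem IsResolventWeight.weightedResolvent_smul (hC : IsResolventWeight C E) (ε : ℝ) (c : ℂ)
    (x : H) (ξ : ℝ) : weightedResolvent C E ε (c • x) ξ = c • weightedResolvent C E ε x ξ := by
  rw [weightedResolvent, map_smul, applyOp_smul c (hC.resolvent_mem _ _)]
  rfl

theorem IsResolventWeight.smul_weightedResolvent (hC : IsResolventWeight C E) {ε ξ : ℝ}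
    (hz : ((ε : ℂ) + (ξ : ℂ) * Complex.I) ∈ operatorResolventSet E) (g : E.domain) :
    ((ε : ℂ) + (ξ : ℂ) * Complex.I) • weightedResolvent C E ε g ξ
      = weightedResolvent C E ε (E g) ξ + applyOp C (g : H) := by
  have h := (isResolventAt_operatorResolvent hz).left_inv g
  rw [map_sub, map_smul, sub_eq_iff_eq_add'] at h
  rw [weightedResolvent, ← applyOp_smul _ (hC.resolvent_mem _ _), h,
    applyOp_add (hC.resolvent_mem _ _) (hC.domain_le g.2)]
  rfl

theorem resolventMean_eq (h : H) (ε : ℝ) : resolventMean C E h ε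
    = ∫⁻ ξ, ‖weightedResolvent C E ε h ξ‖ₑ ^ 2 ∂(ENNReal.ofReal ε • (volume : Measure ℝ)) := by
  rw [lintegral_smul_measure]; rfl

/-- Applied with `φ = C(z - E)⁻¹g`, `ψ = C(z - E)⁻¹Eg` and `c = Cg`. Here `Re⟨ψ, φ⟩ = ε‖φ‖² - Re⟨c,
φ⟩`, and the last term must be split into a small multiple of `‖ψ‖² + ‖φ‖²` and a part integrable in
`ξ` uniformly in `ε`. -/
theorem abs_re_inner_le_of_smul_eq {φ ψ c : K} {ε ξ δ : ℝ} (hε : 0 < ε) (hε1 : ε ≤ 1) (hδ : 0 < δ)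
    (h : ((ε : ℂ) + (ξ : ℂ) * Complex.I) • φ = ψ + c) :
    |(inner ℂ ψ φ).re| ≤ (ε + δ) * (‖ψ‖ ^ 2 + ‖φ‖ ^ 2)
      + (2 + 1 / (2 * δ)) * ‖c‖ ^ 2 * (1 + ξ ^ 2)⁻¹ := by
  set z : ℂ := (ε : ℂ) + (ξ : ℂ) * Complex.I with hz
  have hzre : z.re = ε := by simp [hz]
  have hzim : z.im = ξ := by simp [hz]
  set w : ℂ := 1 + z with hw
  have hwn : ‖w‖ ^ 2 = (1 + ε) ^ 2 + ξ ^ 2 := by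
    rw [← Complex.normSq_eq_norm_sq, Complex.normSq_apply]
    simp [hw, hzre, hzim]; ring
  have hwn1 : 1 + ξ ^ 2 ≤ ‖w‖ ^ 2 := by rw [hwn]; nlinarith
  have hwpos : 0 < ‖w‖ ^ 2 := lt_of_lt_of_le (by positivity) hwn1
  have hself : ∀ x : K, inner ℂ x x = ((‖x‖ ^ 2 : ℝ) : ℂ) := fun x => by
    rw [inner_self_eq_norm_sq_to_K]; simp
  have hw0 : w ≠ 0 := by
    intro h0; rw [h0] at hwpos; simp at hwpos
  have hinv : (‖w‖ ^ 2)⁻¹ ≤ (1 + ξ ^ 2)⁻¹ := inv_anti₀ (by positivity) hwn1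
  -- Dividing by `1 + z` rather than `z` avoids the singularity near `ξ = 0`: `ε∫ dξ/(ε² + ξ²) = π`
  -- does not tend to zero.
  have hφ : φ = w⁻¹ • (ψ + φ + c) := by
    rw [eq_inv_smul_iff₀ hw0, hw, add_smul, one_smul, h]; abel
  have h1 : (inner ℂ ψ φ).re = ε * ‖φ‖ ^ 2 - (inner ℂ c φ).re := by
    have e : ψ = z • φ - c := by rw [h]; abel
    rw [e, inner_sub_left, inner_smul_left, hself, Complex.sub_re,
      Complex.re_mul_ofReal, Complex.conj_re, hzre]
  have h2 : (inner ℂ c φ).re = (w⁻¹ * inner ℂ c (ψ + φ)).re + (w⁻¹).re * ‖c‖ ^ 2 := by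
    conv_lhs => rw [hφ]
    rw [inner_smul_right, inner_add_right c (ψ + φ) c, mul_add, Complex.add_re,
      hself, Complex.re_mul_ofReal]
  have h3 : |(w⁻¹ * inner ℂ c (ψ + φ)).re| ≤ δ * (‖ψ‖ ^ 2 + ‖φ‖ ^ 2)
      + 1 / (2 * δ) * ‖c‖ ^ 2 * (1 + ξ ^ 2)⁻¹ := by
    have k1 : |(w⁻¹ * inner ℂ c (ψ + φ)).re| ≤ (‖w‖⁻¹ * ‖c‖) * (‖ψ‖ + ‖φ‖) := by
      refine (Complex.abs_re_le_norm _).trans ?_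
      rw [norm_mul, norm_inv, mul_assoc]
      refine mul_le_mul_of_nonneg_left ?_ (by positivity)
      exact (norm_inner_le_norm _ _).trans (mul_le_mul_of_nonneg_left (norm_add_le _ _)
        (norm_nonneg _))
    set a := ‖w‖⁻¹ * ‖c‖ with ha
    have k2 : a ^ 2 ≤ ‖c‖ ^ 2 * (1 + ξ ^ 2)⁻¹ := by
      rw [ha, mul_pow, inv_pow, mul_comm]
      exact mul_le_mul_of_nonneg_left hinv (by positivity)
    have k3 : a * (‖ψ‖ + ‖φ‖) ≤ δ * (‖ψ‖ ^ 2 + ‖φ‖ ^ 2) + 1 / (2 * δ) * a ^ 2 := by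
      have e : δ * (‖ψ‖ ^ 2 + ‖φ‖ ^ 2) + 1 / (2 * δ) * a ^ 2 - a * (‖ψ‖ + ‖φ‖)
          = ((δ * (‖ψ‖ + ‖φ‖) - a) ^ 2 + δ ^ 2 * (‖ψ‖ - ‖φ‖) ^ 2) / (2 * δ) := by
        field_simp; ring
      have : 0 ≤ ((δ * (‖ψ‖ + ‖φ‖) - a) ^ 2 + δ ^ 2 * (‖ψ‖ - ‖φ‖) ^ 2) / (2 * δ) := by positivity
      linarith
    have k4 : 1 / (2 * δ) * a ^ 2 ≤ 1 / (2 * δ) * (‖c‖ ^ 2 * (1 + ξ ^ 2)⁻¹) :=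
      mul_le_mul_of_nonneg_left k2 (by positivity)
    rw [mul_assoc]
    linarith
  -- Only the real part of `w⁻¹` enters. It decays like `ξ⁻²`, whereas `‖w⁻¹‖` itself is not
  -- integrable.
  have h4 : |(w⁻¹).re * ‖c‖ ^ 2| ≤ 2 * ‖c‖ ^ 2 * (1 + ξ ^ 2)⁻¹ := by
    have e : (w⁻¹).re = (1 + ε) * (‖w‖ ^ 2)⁻¹ := by
      rw [Complex.inv_re, Complex.normSq_eq_norm_sq, div_eq_mul_inv]
      simp [hw, hzre]
    rw [e, abs_of_nonneg (by positivity)]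
    have : (1 + ε) * (‖w‖ ^ 2)⁻¹ ≤ 2 * (1 + ξ ^ 2)⁻¹ :=
      mul_le_mul (by linarith) hinv (by positivity) (by norm_num)
    nlinarith [sq_nonneg ‖c‖]
  have h5 : |ε * ‖φ‖ ^ 2| ≤ ε * (‖ψ‖ ^ 2 + ‖φ‖ ^ 2) := by
    rw [abs_of_nonneg (by positivity)]
    nlinarith [sq_nonneg ‖ψ‖]
  rw [h1, h2]
  rw [abs_le] at h3 h4 h5 ⊢
  constructor <;> linarith

theorem IsResolventWeight.abs_re_integral_inner_le (hC : IsResolventWeight C E)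
    (hρ : ∀ z : ℂ, 0 < z.re → z ∈ operatorResolventSet E) (g : E.domain) {ε δ B : ℝ} (hε : 0 < ε)
    (hε1 : ε ≤ 1) (hδ : 0 < δ)
    (h1 : resolventMean C E (E g) ε ≤ ENNReal.ofReal B)
    (h2 : resolventMean C E g ε ≤ ENNReal.ofReal B) (hB : 0 ≤ B) :
    |(∫ ξ, inner ℂ (weightedResolvent C E ε (E g) ξ) (weightedResolvent C E ε g ξ)
      ∂(ENNReal.ofReal ε • (volume : Measure ℝ))).re|
      ≤ (ε + δ) * (B + B) + (2 + 1 / (2 * δ)) * ‖applyOp C (g : H)‖ ^ 2 * (ε * Real.pi) := by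
  set μ : Measure ℝ := ENNReal.ofReal ε • (volume : Measure ℝ) with hμ
  set φ := weightedResolvent C E ε g with hφdef
  set ψ := weightedResolvent C E ε (E g) with hψdef
  rw [resolventMean_eq] at h1 h2
  have hψ : MemLp ψ 2 μ := memLp_two_of_lintegral_lt_top
    ((hC.measurable ε hε _).smul_measure _) (h1.trans_lt ENNReal.ofReal_lt_top)
  have hφ : MemLp φ 2 μ := memLp_two_of_lintegral_lt_top
    ((hC.measurable ε hε _).smul_measure _) (h2.trans_lt ENNReal.ofReal_lt_top)
  have iψ := (memLp_two_iff_integrable_sq_norm hψ.1).1 hψ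
  have iφ := (memLp_two_iff_integrable_sq_norm hφ.1).1 hφ
  have iw : Integrable (fun ξ : ℝ => (1 + ξ ^ 2)⁻¹) μ :=
    integrable_inv_one_add_sq.smul_measure ENNReal.ofReal_ne_top
  have hw : ∫ ξ : ℝ, (1 + ξ ^ 2)⁻¹ ∂μ = ε * Real.pi := by
    rw [hμ, integral_smul_measure, integral_univ_inv_one_add_sq, ENNReal.toReal_ofReal hε.le]
    rfl
  have kψ : ∫ ξ, ‖ψ ξ‖ ^ 2 ∂μ ≤ B := by
    rw [hψ.integral_norm_sq]; exact ENNReal.toReal_le_of_le_ofReal hB h1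
  have kφ : ∫ ξ, ‖φ ξ‖ ^ 2 ∂μ ≤ B := by
    rw [hφ.integral_norm_sq]; exact ENNReal.toReal_le_of_le_ofReal hB h2
  have iin := hψ.integrable_inner hφ
  have hre : (∫ ξ, inner ℂ (ψ ξ) (φ ξ) ∂μ).re = ∫ ξ, (inner ℂ (ψ ξ) (φ ξ)).re ∂μ :=
    (integral_re iin).symm
  have isum : Integrable (fun ξ => ‖ψ ξ‖ ^ 2 + ‖φ ξ‖ ^ 2) μ := iψ.add iφ
  have ibound : Integrable (fun ξ => (ε + δ) * (‖ψ ξ‖ ^ 2 + ‖φ ξ‖ ^ 2)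
      + (2 + 1 / (2 * δ)) * ‖applyOp C (g : H)‖ ^ 2 * (1 + ξ ^ 2)⁻¹) μ :=
    (isum.const_mul _).add (iw.const_mul _)
  rw [hre, ← Real.norm_eq_abs]
  refine (norm_integral_le_of_norm_le ibound (Eventually.of_forall fun ξ => ?_)).trans ?_
  · exact abs_re_inner_le_of_smul_eq hε hε1 hδ
      (hC.smul_weightedResolvent (hρ _ (by simpa using hε)) g)
  · rw [integral_add (isum.const_mul _) (iw.const_mul _), integral_const_mul,
      integral_const_mul, integral_add iψ iφ, hw]
    gcongr

variable [CompleteSpace H]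

/-- `Q` is the limit of the Gram forms of `ξ ↦ C(ε + iξ - E)⁻¹h` for the measure `ε dξ`. Skewness
follows from `IsResolventWeight.abs_re_integral_inner_le`, since the total mass `επ` of `(1 + ξ²)⁻¹`
vanishes in the limit. -/
theorem IsResolventWeight.exists_form (hC : IsResolventWeight C E)
    (hρ : ∀ z : ℂ, 0 < z.re → z ∈ operatorResolventSet E) {α β : ℝ} (hα : 0 < α) (hβ : 0 < β)
    (hmean : ∀ h : H, limsup (resolventMean C E h) (𝓝[>] 0) ≤ ENNReal.ofReal (β * ‖h‖ ^ 2) ∧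
      ENNReal.ofReal (α * ‖h‖ ^ 2) ≤ liminf (resolventMean C E h) (𝓝[>] 0)) :
    ∃ Q : H →L[ℂ] H, Q.IsPositive ∧ (∀ x, α / 2 * ‖x‖ ^ 2 ≤ (inner ℂ (Q x) x).re) ∧
      (∀ x, (inner ℂ (Q x) x).re ≤ 2 * β * ‖x‖ ^ 2) ∧
      ∀ g : E.domain, (inner ℂ (Q (E g)) (g : H)).re = 0 := by
  have hzero : ∀ ε, resolventMean C E 0 ε = 0 := fun ε => by
    have : applyOp C (0 : H) = 0 := by
      simpa using applyOp_smul (C := C) 0 C.domain.zero_mem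
    simp [resolventMean, this]
  -- Doubling `β`, and halving `α` below, makes the comparison strict for `x ≠ 0`, so the bounds on
  -- the upper and lower limits hold eventually for the means themselves.
  have hup : ∀ x, ∀ᶠ ε in 𝓝[>] (0 : ℝ), resolventMean C E x ε ≤ ENNReal.ofReal (2 * β * ‖x‖ ^ 2) := by
    intro x
    rcases eq_or_ne x 0 with rfl | hx
    · simp [hzero]
    · have hx' : 0 < ‖x‖ := norm_pos_iff.2 hx
      refine (eventually_lt_of_limsup_lt ((hmean x).1.trans_lt ?_)).mono fun ε h => h.le
      rw [ENNReal.ofReal_lt_ofReal_iff (by positivity)]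
      have : 0 < β * ‖x‖ ^ 2 := by positivity
      linarith
  have hlow : ∀ x, ∀ᶠ ε in 𝓝[>] (0 : ℝ), ENNReal.ofReal (α / 2 * ‖x‖ ^ 2) ≤ resolventMean C E x ε := by
    intro x
    rcases eq_or_ne x 0 with rfl | hx
    · simp
    · have hx' : 0 < ‖x‖ := norm_pos_iff.2 hx
      refine (eventually_lt_of_lt_liminf (lt_of_lt_of_le ?_ (hmean x).2)).mono fun ε h => h.le
      rw [ENNReal.ofReal_lt_ofReal_iff (by positivity)]
      have : 0 < α * ‖x‖ ^ 2 := by positivity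
      linarith
  set 𝒰 : Ultrafilter ℝ := Ultrafilter.of (𝓝[>] 0)
  have h𝒰 : (𝒰 : Filter ℝ) ≤ 𝓝[>] 0 := Ultrafilter.of_le _
  have hpos : ∀ᶠ ε in (𝒰 : Filter ℝ), (0 : ℝ) < ε := h𝒰 self_mem_nhdsWithin
  obtain ⟨Q, hQ, hQlim, hQself⟩ := 𝒰.exists_isPositive_tendsto
    (μ := fun ε => ENNReal.ofReal ε • (volume : Measure ℝ)) (F := weightedResolvent C E)
    (M := √(2 * β)) (Real.sqrt_nonneg _) hC.weightedResolvent_add hC.weightedResolvent_smul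
    (fun x => hpos.mono fun ε hε => (hC.measurable ε hε x).smul_measure _)
    (fun x => ((hup x).filter_mono h𝒰).mono fun ε hε => by
      rw [← resolventMean_eq, mul_pow, Real.sq_sqrt (by positivity)]
      exact hε)
  simp_rw [← resolventMean_eq] at hQself
  refine ⟨Q, hQ, fun x => ?_, fun x => ?_, fun g => ?_⟩
  · refine ge_of_tendsto (hQself x) ?_
    filter_upwards [h𝒰 (hlow x), h𝒰 (hup x)] with ε h1 h2
    exact (ENNReal.ofReal_le_iff_le_toReal (ne_top_of_le_ne_top ENNReal.ofReal_ne_top h2)).1 h1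
  · refine le_of_tendsto (hQself x) ?_
    filter_upwards [h𝒰 (hup x)] with ε h
    exact ENNReal.toReal_le_of_le_ofReal (by positivity) h
  · set B : ℝ := max (2 * β * ‖E g‖ ^ 2) (2 * β * ‖(g : H)‖ ^ 2)
    have hB : 0 ≤ B := le_max_of_le_left (by positivity)
    -- The constant `1/(2δ)` blows up, so `ε → 0` is taken first at fixed `δ`, and `δ → 0`
    -- afterwards.
    have hle : ∀ δ : ℝ, 0 < δ → |(inner ℂ (Q (E g)) (g : H)).re| ≤ δ * (B + B) := by
      intro δ hδ
      have hl := ((Complex.continuous_re.tendsto _).comp (hQlim (E g) g)).abs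
      have hr : Tendsto (fun ε : ℝ => (ε + δ) * (B + B)
          + (2 + 1 / (2 * δ)) * ‖applyOp C (g : H)‖ ^ 2 * (ε * Real.pi)) (𝒰 : Filter ℝ)
          (𝓝 (δ * (B + B))) := by
        have hcont : Continuous (fun ε : ℝ => (ε + δ) * (B + B)
          + (2 + 1 / (2 * δ)) * ‖applyOp C (g : H)‖ ^ 2 * (ε * Real.pi)) := by fun_prop
        have := (hcont.tendsto 0).mono_left (h𝒰.trans nhdsWithin_le_nhds)
        simpa using this
      refine le_of_tendsto_of_tendsto hl hr ?_
      have h01 : ∀ᶠ ε in 𝓝[>] (0 : ℝ), ε < 1 := nhdsWithin_le_nhds (gt_mem_nhds one_pos)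
      filter_upwards [hpos, h𝒰 h01, h𝒰 (hup (E g)), h𝒰 (hup (g : H))] with ε hε hε1 h1 h2
      exact hC.abs_re_integral_inner_le hρ g hε hε1.le hδ
        (h1.trans (ENNReal.ofReal_le_ofReal (le_max_left _ _)))
        (h2.trans (ENNReal.ofReal_le_ofReal (le_max_right _ _))) hB
    have hlim : Tendsto (fun δ : ℝ => δ * (B + B)) (𝓝[>] 0) (𝓝 0) := by
      have : Continuous fun δ : ℝ => δ * (B + B) := by fun_prop
      simpa using (this.tendsto 0).mono_left nhdsWithin_le_nhds
    have h0 := ge_of_tendsto hlim (eventually_mem_nhdsWithin.mono fun δ hδ => hle δ hδ)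
    exact abs_nonpos_iff.1 h0

/-- Two-sided bounds on the weighted resolvent means force `E` to generate a semigroup which is
bounded from above and from below. -/
theorem IsResolventWeight.exists_isC0Semigroup (hC : IsResolventWeight C E)
    (hρ : ∀ z : ℂ, 0 < z.re → z ∈ operatorResolventSet E) {α β : ℝ} (hα : 0 < α) (hβ : 0 < β)
    (hmean : ∀ h : H, limsup (resolventMean C E h) (𝓝[>] 0) ≤ ENNReal.ofReal (β * ‖h‖ ^ 2) ∧
      ENNReal.ofReal (α * ‖h‖ ^ 2) ≤ liminf (resolventMean C E h) (𝓝[>] 0)) :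
    ∃ T : ℝ → H →L[ℂ] H, IsC0Semigroup T ∧ IsGeneratorOf E T ∧ ∃ m M : ℝ, 0 < m ∧
      ∀ t : ℝ, 0 ≤ t → ∀ h, m * ‖h‖ ^ 2 ≤ ‖T t h‖ ^ 2 ∧ ‖T t h‖ ^ 2 ≤ M * ‖h‖ ^ 2 := by
  obtain ⟨Q, hQ, hl, hu, hskew⟩ := hC.exists_form hρ hα hβ hmean
  obtain ⟨T, hT, hE, h⟩ := exists_isC0Semigroup_of_skew hQ (half_pos hα)
    (mul_pos two_pos hβ) hl hu hskew (R := fun r => operatorResolvent E r)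
    (fun r hr => isResolventAt_operatorResolvent (hρ r (by simpa using hr)))
  exact ⟨T, hT, hE, _, _, by positivity, h⟩

end ResolventMeans

/-! ### Plancherel's theorem for Hilbert space valued functions -/

section Plancherel

open FourierTransform SchwartzMap

variable {F : Type*} [NormedAddCommGroup F] [InnerProductSpace ℂ F]

theorem continuous_fourier_of_integrable {f : ℝ → F} (hf : Integrable f) : Continuous (𝓕 f) :=
  VectorFourier.fourierIntegral_continuous Real.continuous_fourierChar
    (continuous_inner (𝕜 := ℝ)) hf

variable [CompleteSpace F]

/-- Both transforms give the same integrals against smooth compactly supported `g`: the transform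
moves onto `g`, through tempered distributions for the `L²` version and through Fubini for the
integral version. -/
theorem fourier_toLp_ae_eq {f : ℝ → F} (hf : Integrable f) (hf2 : MemLp f 2) :
    (𝓕 (hf2.toLp f) : Lp F 2 (volume : Measure ℝ)) =ᵐ[volume] 𝓕 f := by
  refine ae_eq_of_integral_contDiff_smul_eq
    ((Lp.memLp (𝓕 (hf2.toLp f))).locallyIntegrable one_le_two)
    (continuous_fourier_of_integrable hf).locallyIntegrable fun g hg hgc => ?_
  have hg₁ : HasCompactSupport (Complex.ofRealCLM ∘ g) := hgc.comp_left rfl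
  have hg₂ : ContDiff ℝ (⊤ : ℕ∞) (Complex.ofRealCLM ∘ g) := Complex.ofRealCLM.contDiff.comp hg
  set φ : 𝓢(ℝ, ℂ) := hg₁.toSchwartzMap hg₂ with hφ
  have hφg : ∀ x, φ x = (g x : ℂ) := fun x => rfl
  have h1 : ∫ x, φ x • (𝓕 (hf2.toLp f) : Lp F 2 (volume : Measure ℝ)) x
      = ∫ x, (𝓕 φ) x • (hf2.toLp f) x := by
    have := congrArg (fun D : TemperedDistribution ℝ F => D φ)
      (Lp.fourier_toTemperedDistribution_eq (hf2.toLp f))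
    simpa using this.symm
  have h2 : ∫ x, (𝓕 φ) x • (hf2.toLp f) x = ∫ x, (𝓕 φ) x • f x := by
    refine integral_congr_ae ?_
    filter_upwards [hf2.coeFn_toLp] with x hx
    rw [hx]
  have h3 : ∫ x, (𝓕 φ) x • f x = ∫ x, φ x • 𝓕 f x := by
    simpa [SchwartzMap.fourier_coe] using! VectorFourier.integral_fourierIntegral_smul_eq_flip (L := innerₗ ℝ)
      Real.continuous_fourierChar (continuous_inner (𝕜 := ℝ)) φ.integrable hf
  have h4 := h1.trans (h2.trans h3)
  simpa only [hφg, Complex.coe_smul] using h4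

/-- **Plancherel's theorem** for functions in `L¹ ∩ L²` with values in a Hilbert space. -/
theorem lintegral_enorm_fourier_sq {f : ℝ → F} (hf : Integrable f) (hf2 : MemLp f 2) :
    ∫⁻ w, ‖𝓕 f w‖ₑ ^ 2 = ∫⁻ x, ‖f x‖ₑ ^ 2 := by
  rw [← eLpNorm_two_pow_two_eq_lintegral, ← eLpNorm_two_pow_two_eq_lintegral,
    ← eLpNorm_congr_ae (fourier_toLp_ae_eq hf hf2), ← Lp.enorm_def, ← ofReal_norm,
    Lp.norm_fourier_eq, ofReal_norm, Lp.enorm_toLp]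

theorem lintegral_comp_div {a : ℝ} (ha : 0 < a) (f : ℝ → ENNReal) :
    ∫⁻ x, f (x / a) = ENNReal.ofReal a * ∫⁻ x, f x := by
  have e : ∀ x : ℝ, x / a = Homeomorph.mulRight₀ a⁻¹ (inv_ne_zero ha.ne') x := fun x =>
    div_eq_mul_inv x a
  have h := Real.map_volume_mul_right (inv_ne_zero ha.ne')
  rw [inv_inv, abs_of_pos ha] at h
  have h2 := lintegral_map_equiv (μ := volume) f
    (Homeomorph.mulRight₀ a⁻¹ (inv_ne_zero ha.ne')).toMeasurableEquiv
  simp_rw [e]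
  rw [← smul_eq_mul, ← lintegral_smul_measure, ← h]
  exact h2.symm

end Plancherel

/-! ### The resolvent as a Laplace transform -/

section LaplaceTransform

variable {H : Type u} [NormedAddCommGroup H] [InnerProductSpace ℂ H]
variable {T : ℝ → H →L[ℂ] H} {M : ℝ}

theorem IsC0Semigroup.continuous_abs_orbit (hT : IsC0Semigroup T)
    (hM : ∀ t : ℝ, 0 ≤ t → ∀ h, ‖T t h‖ ≤ M * ‖h‖) (h : H) : Continuous fun t : ℝ => T |t| h :=
  (hT.continuousOn_orbit hM h).comp_continuous continuous_abs fun t => abs_nonneg t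

theorem IsC0Semigroup.continuous_exp_smul_orbit (hT : IsC0Semigroup T)
    (hM : ∀ t : ℝ, 0 ≤ t → ∀ h, ‖T t h‖ ≤ M * ‖h‖) (z : ℂ) (h : H) :
    Continuous fun t : ℝ => Complex.exp (-z * t) • T |t| h :=
  (Complex.continuous_exp.comp (continuous_const.mul Complex.continuous_ofReal)).smul
    (hT.continuous_abs_orbit hM h)

theorem norm_exp_smul_orbit_le (hM : ∀ t : ℝ, 0 ≤ t → ∀ h, ‖T t h‖ ≤ M * ‖h‖) (z : ℂ) (h : H)
    (t : ℝ) : ‖Complex.exp (-z * t) • T |t| h‖ ≤ Real.exp (-z.re * t) * (M * ‖h‖) := by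
  rw [norm_smul, Complex.norm_exp]
  have : (-z * (t : ℂ)).re = -z.re * t := by simp
  rw [this]
  exact mul_le_mul_of_nonneg_left (hM _ (abs_nonneg t) h) (Real.exp_nonneg _)

theorem IsC0Semigroup.integrableOn_exp_smul_orbit (hT : IsC0Semigroup T)
    (hM : ∀ t : ℝ, 0 ≤ t → ∀ h, ‖T t h‖ ≤ M * ‖h‖) {z : ℂ} (hz : 0 < z.re) (h : H) :
    IntegrableOn (fun t : ℝ => Complex.exp (-z * t) • T |t| h) (Set.Ioi 0) := by
  refine Integrable.mono' ((exp_neg_integrableOn_Ioi 0 hz).mul_const (M * ‖h‖))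
    (hT.continuous_exp_smul_orbit hM z h).aestronglyMeasurable
    (Eventually.of_forall fun t => norm_exp_smul_orbit_le hM z h t)

theorem norm_laplace_le (hM : ∀ t : ℝ, 0 ≤ t → ∀ h, ‖T t h‖ ≤ M * ‖h‖) {z : ℂ} (hz : 0 < z.re) (h : H) :
    ‖∫ t : ℝ in Set.Ioi 0, Complex.exp (-z * t) • T |t| h‖ ≤ M / z.re * ‖h‖ := by
  refine (norm_integral_le_of_norm_le ((exp_neg_integrableOn_Ioi 0 hz).mul_const (M * ‖h‖))
    (Eventually.of_forall fun t => norm_exp_smul_orbit_le hM z h t)).trans ?_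
  rw [integral_mul_const, integral_exp_mul_Ioi (by linarith)]
  refine le_of_eq ?_
  rw [mul_zero, Real.exp_zero, neg_div_neg_eq]
  ring

theorem IsC0Semigroup.exists_laplace_clm (hT : IsC0Semigroup T)
    (hM : ∀ t : ℝ, 0 ≤ t → ∀ h, ‖T t h‖ ≤ M * ‖h‖) {z : ℂ} (hz : 0 < z.re) :
    ∃ L : H →L[ℂ] H, ∀ h, L h = ∫ t : ℝ in Set.Ioi 0, Complex.exp (-z * t) • T |t| h := by
  have hi := hT.integrableOn_exp_smul_orbit hM hz
  refine ⟨LinearMap.mkContinuous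
    { toFun := fun h => ∫ t : ℝ in Set.Ioi 0, Complex.exp (-z * t) • T |t| h
      map_add' := fun x y => ?_
      map_smul' := fun c x => ?_ } (M / z.re) (norm_laplace_le hM hz), fun h => rfl⟩
  · rw [← integral_add (hi x) (hi y)]
    simp_rw [ContinuousLinearMap.map_add, smul_add]
  · rw [RingHom.id_apply, ← integral_smul]
    simp_rw [map_smul, smul_comm c]

variable [CompleteSpace H]

/-- Substituting in the semigroup law gives `e^{zs}` times the tail integral over `(s, ∞)`. In this
form the dependence on `s` can be differentiated for every `h`, not only for `h` in the domain of
the generator. -/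
theorem IsC0Semigroup.apply_laplace (hT : IsC0Semigroup T)
    (hM : ∀ t : ℝ, 0 ≤ t → ∀ h, ‖T t h‖ ≤ M * ‖h‖) {z : ℂ} (hz : 0 < z.re) (h : H) {s : ℝ}
    (hs : 0 ≤ s) : T s (∫ t : ℝ in Set.Ioi 0, Complex.exp (-z * t) • T |t| h)
      = Complex.exp (z * s) • ((∫ t : ℝ in Set.Ioi 0, Complex.exp (-z * t) • T |t| h)
        - ∫ t in (0 : ℝ)..s, Complex.exp (-z * t) • T |t| h) := by
  have hi := hT.integrableOn_exp_smul_orbit hM hz h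
  have h1 := intervalIntegral.integral_Ioi_sub_Ioi hi hs
  have h2 : ∫ t : ℝ in Set.Ioi s, Complex.exp (-z * t) • T |t| h
      = ∫ t : ℝ in Set.Ioi 0, Complex.exp (-z * (t + s : ℝ)) • T |t + s| h := by
    have := (measurePreserving_add_right volume s).setIntegral_preimage_emb
      (measurableEmbedding_addRight s) (fun t : ℝ => Complex.exp (-z * t) • T |t| h) (Set.Ioi s)
    simpa using this.symm
  rw [← h1, sub_sub_cancel, h2, ← ContinuousLinearMap.integral_comp_comm _ hi, ← integral_smul]
  refine setIntegral_congr_fun measurableSet_Ioi fun t ht => ?_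
  have ht' : (0 : ℝ) < t := ht
  rw [map_smul, smul_smul, ← Complex.exp_add, abs_of_pos ht', abs_of_pos (by linarith : 0 < t + s),
    add_comm t s, hT.apply_add hs ht'.le]
  congr 2
  push_cast
  ring

/-- The resolvent of the generator of a bounded semigroup is its Laplace transform. -/
theorem IsC0Semigroup.isResolventAt_laplace (hT : IsC0Semigroup T)
    (hM : ∀ t : ℝ, 0 ≤ t → ∀ h, ‖T t h‖ ≤ M * ‖h‖) {E : H →ₗ.[ℂ] H} (hE : IsGeneratorOf E T)
    {z : ℂ} (hz : 0 < z.re) {L : H →L[ℂ] H}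
    (hL : ∀ h, L h = ∫ t : ℝ in Set.Ioi 0, Complex.exp (-z * t) • T |t| h) :
    IsResolventAt E z L := by
  -- The right derivative of `T(s)Lh` at `s = 0` comes from the product rule: `z Lh` from the
  -- exponential and `-h` from the integral.
  have hgraph : ∀ h, (L h, z • L h - h) ∈ E.graph := by
    intro h
    rw [hE]
    have hk := hT.continuous_exp_smul_orbit hM z h
    have hint : HasDerivAt (fun s : ℝ => ∫ t in (0 : ℝ)..s, Complex.exp (-z * t) • T |t| h) h 0 := by
      have := intervalIntegral.integral_hasDerivAt_right (hk.intervalIntegrable 0 0)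
        (hk.stronglyMeasurableAtFilter _ _) hk.continuousAt
      simpa [hT.map_zero] using this
    have hexp : HasDerivAt (fun s : ℝ => Complex.exp (z * s)) z 0 := by
      have h1 : HasDerivAt (fun s : ℝ => z * (s : ℂ)) z 0 := by
        simpa using (Complex.ofRealCLM.hasDerivAt (x := 0)).const_mul z
      simpa using h1.cexp
    have hd := (hexp.fun_smul ((hasDerivAt_const (0 : ℝ) (L h)).fun_sub hint)).hasDerivWithinAt
      (s := Set.Ioi 0)
    rw [hasDerivWithinAt_iff_tendsto_slope' (by simp)] at hd
    have e : Complex.exp (z * (0 : ℝ)) • (0 - h)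
        + z • (L h - ∫ t in (0 : ℝ)..0, Complex.exp (-z * t) • T |t| h) = z • L h - h := by
      simp; abel
    rw [e] at hd
    refine hd.congr' ?_
    filter_upwards [self_mem_nhdsWithin] with s hs
    have hs' : (0 : ℝ) < s := hs
    rw [slope_def_module, hL, hT.apply_laplace hM hz h hs'.le]
    simp [← Complex.ofReal_inv]
  have hmem : ∀ h, ∃ y : E.domain, (y : H) = L h ∧ E y = z • L h - h := fun h => by
    obtain ⟨y, h1, h2⟩ := (LinearPMap.mem_graph_iff E).1 (hgraph h)
    exact ⟨y, h1, h2⟩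
  refine ⟨fun h => ?_, fun x => ?_⟩
  · obtain ⟨y, hy, hEy⟩ := hmem h
    refine ⟨hy ▸ y.2, ?_⟩
    have : (⟨L h, hy ▸ y.2⟩ : E.domain) = y := Subtype.ext hy.symm
    rw [this, hEy, sub_sub_cancel]
  -- Left inverse: `y - x` is an eigenvector for `z` with positive real part, hence zero.
  · obtain ⟨y, hy, hEy⟩ := hmem (z • (x : H) - E x)
    have h1 : E (y - x) = z • ((y : H) - x) := by
      rw [LinearPMap.map_sub, hEy, ← hy, smul_sub]; abel
    have h2 := hE.tendsto (y - x)
    rw [h1] at h2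
    have h3 := hT.eq_zero_of_eigenvector hM hz h2
    rw [← hy]
    exact sub_eq_zero.1 h3

theorem IsC0Semigroup.operatorResolvent_apply (hT : IsC0Semigroup T)
    (hM : ∀ t : ℝ, 0 ≤ t → ∀ h, ‖T t h‖ ≤ M * ‖h‖) {E : H →ₗ.[ℂ] H} (hE : IsGeneratorOf E T)
    {z : ℂ} (hz : 0 < z.re) : z ∈ operatorResolventSet E ∧
      ∀ h, operatorResolvent E z h = ∫ t : ℝ in Set.Ioi 0, Complex.exp (-z * t) • T |t| h := by
  obtain ⟨L, hL⟩ := hT.exists_laplace_clm hM hz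
  have h1 := hT.isResolventAt_laplace hM hE hz hL
  refine ⟨⟨L, h1⟩, fun h => ?_⟩
  rw [(isResolventAt_operatorResolvent ⟨L, h1⟩).unique h1, hL]

end LaplaceTransform

/-! ### Resolvent means of a bounded semigroup -/

section ResolventMeansOfSemigroup

open FourierTransform

variable {H : Type u} [NormedAddCommGroup H] [InnerProductSpace ℂ H]
variable {T : ℝ → H →L[ℂ] H} {E : H →ₗ.[ℂ] H} {m M : ℝ}

/-- `e^{-εt} T(t) h` for `t > 0`, extended by zero. -/
noncomputable def dampedOrbit (T : ℝ → H →L[ℂ] H) (ε : ℝ) (h : H) : ℝ → H :=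
  (Set.Ioi (0 : ℝ)).indicator fun t : ℝ => Complex.exp (-(ε : ℂ) * t) • T |t| h

theorem lintegral_exp_neg_two_mul {ε : ℝ} (hε : 0 < ε) (c : ℝ) :
    ∫⁻ t : ℝ in Set.Ioi 0, ENNReal.ofReal (Real.exp (-(2 * ε) * t) * c)
      = ENNReal.ofReal (c / (2 * ε)) := by
  have h0 : 0 < 2 * ε := by positivity
  simp_rw [ENNReal.ofReal_mul (Real.exp_nonneg _)]
  rw [lintegral_mul_const _ (by fun_prop), ← ofReal_integral_eq_lintegral_ofReal
    (exp_neg_integrableOn_Ioi 0 h0) (Eventually.of_forall fun t => Real.exp_nonneg _),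
    integral_exp_mul_Ioi (by linarith), ← ENNReal.ofReal_mul (by simpa using h0.le)]
  congr 1
  rw [mul_zero, Real.exp_zero, neg_div_neg_eq]
  ring

theorem lintegral_enorm_dampedOrbit_sq (T : ℝ → H →L[ℂ] H) (ε : ℝ) (h : H) :
    ∫⁻ t, ‖dampedOrbit T ε h t‖ₑ ^ 2
      = ∫⁻ t : ℝ in Set.Ioi 0, ‖Complex.exp (-(ε : ℂ) * t) • T |t| h‖ₑ ^ 2 := by
  rw [← lintegral_indicator measurableSet_Ioi]
  congr 1
  ext t
  by_cases ht : t ∈ Set.Ioi (0 : ℝ) <;> simp [dampedOrbit, ht]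

theorem norm_exp_smul_sq (ε t : ℝ) (x : H) :
    ‖Complex.exp (-(ε : ℂ) * t) • x‖ ^ 2 = Real.exp (-(2 * ε) * t) * ‖x‖ ^ 2 := by
  rw [norm_smul, mul_pow, Complex.norm_exp, ← Real.exp_nat_mul]
  congr 2
  simp; ring

theorem lintegral_enorm_dampedOrbit_sq_le (h : H)
    (hM : ∀ t : ℝ, 0 ≤ t → ‖T t h‖ ^ 2 ≤ M * ‖h‖ ^ 2) {ε : ℝ} (hε : 0 < ε) :
    ∫⁻ t, ‖dampedOrbit T ε h t‖ₑ ^ 2 ≤ ENNReal.ofReal (M * ‖h‖ ^ 2 / (2 * ε)) := by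
  rw [lintegral_enorm_dampedOrbit_sq, ← lintegral_exp_neg_two_mul hε]
  refine lintegral_mono fun t => enorm_sq_le_ofReal ?_
  rw [norm_exp_smul_sq]
  exact mul_le_mul_of_nonneg_left (hM _ (abs_nonneg t)) (Real.exp_nonneg _)

theorem le_lintegral_enorm_dampedOrbit_sq (h : H)
    (hm : ∀ t : ℝ, 0 ≤ t → m * ‖h‖ ^ 2 ≤ ‖T t h‖ ^ 2) {ε : ℝ} (hε : 0 < ε) :
    ENNReal.ofReal (m * ‖h‖ ^ 2 / (2 * ε)) ≤ ∫⁻ t, ‖dampedOrbit T ε h t‖ₑ ^ 2 := by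
  rw [lintegral_enorm_dampedOrbit_sq, ← lintegral_exp_neg_two_mul hε]
  refine lintegral_mono fun t => ofReal_le_enorm_sq ?_
  rw [norm_exp_smul_sq]
  exact mul_le_mul_of_nonneg_left (hm _ (abs_nonneg t)) (Real.exp_nonneg _)

theorem IsC0Semigroup.integrable_dampedOrbit (hT : IsC0Semigroup T)
    (hM : ∀ t : ℝ, 0 ≤ t → ∀ h, ‖T t h‖ ≤ M * ‖h‖) {ε : ℝ} (hε : 0 < ε) (h : H) :
    Integrable (dampedOrbit T ε h) :=
  (integrable_indicator_iff measurableSet_Ioi).2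
    (hT.integrableOn_exp_smul_orbit hM (z := ε) (by simpa using hε) h)

variable [CompleteSpace H]

/-- The frequency is `ξ / (2π)` because `𝓕` uses the kernel `e^{-2πiwt}`; the change of variables
later contributes the factor `2π` to the mean. -/
theorem IsC0Semigroup.operatorResolvent_eq_fourier (hT : IsC0Semigroup T)
    (hM : ∀ t : ℝ, 0 ≤ t → ∀ h, ‖T t h‖ ≤ M * ‖h‖) (hE : IsGeneratorOf E T) {ε : ℝ} (hε : 0 < ε)
    (h : H) (ξ : ℝ) : operatorResolvent E ((ε : ℂ) + (ξ : ℂ) * Complex.I) h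
      = 𝓕 (dampedOrbit T ε h) (ξ / (2 * Real.pi)) := by
  rw [(hT.operatorResolvent_apply hM hE (by simpa using hε)).2, Real.fourier_real_eq_integral_exp_smul,
    ← integral_indicator measurableSet_Ioi]
  congr 1
  ext t
  by_cases ht : t ∈ Set.Ioi (0 : ℝ)
  · rw [dampedOrbit, Set.indicator_of_mem ht, Set.indicator_of_mem ht, smul_smul,
      ← Complex.exp_add]
    congr 2
    have := Real.pi_ne_zero
    push_cast
    field_simp
    ring
  · rw [dampedOrbit, Set.indicator_of_notMem ht, Set.indicator_of_notMem ht, smul_zero]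

theorem IsC0Semigroup.isResolventWeight_idPMap (hT : IsC0Semigroup T)
    (hM : ∀ t : ℝ, 0 ≤ t → ∀ h, ‖T t h‖ ≤ M * ‖h‖) (hE : IsGeneratorOf E T) :
    IsResolventWeight (idPMap H) E where
  dense := by rw [idPMap_domain]; exact dense_univ
  domain_le := by rw [idPMap_domain]; exact le_top
  measurable ε hε h := by
    simp_rw [applyOp_idPMap, hT.operatorResolvent_eq_fourier hM hE hε]
    exact ((continuous_fourier_of_integrable (hT.integrable_dampedOrbit hM hε h)).comp
      (continuous_id.div_const _)).aestronglyMeasurable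

theorem IsC0Semigroup.resolventMean_idPMap (hT : IsC0Semigroup T)
    (hM : ∀ t : ℝ, 0 ≤ t → ∀ h, ‖T t h‖ ^ 2 ≤ M * ‖h‖ ^ 2) (hE : IsGeneratorOf E T) {ε : ℝ}
    (hε : 0 < ε) (h : H) : resolventMean (idPMap H) E h ε
      = ENNReal.ofReal (2 * ε * Real.pi) * ∫⁻ t, ‖dampedOrbit T ε h t‖ₑ ^ 2 := by
  have hM' : ∀ t : ℝ, 0 ≤ t → ∀ h, ‖T t h‖ ≤ √M * ‖h‖ := fun t ht h => norm_le_sqrt_mul (hM t ht h)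
  have hi := hT.integrable_dampedOrbit hM' hε h
  have hi2 : MemLp (dampedOrbit T ε h) 2 := memLp_two_of_lintegral_lt_top hi.1
    ((lintegral_enorm_dampedOrbit_sq_le h (fun t ht => hM t ht h) hε).trans_lt
      ENNReal.ofReal_lt_top)
  simp_rw [resolventMean, applyOp_idPMap, hT.operatorResolvent_eq_fourier hM' hE hε]
  rw [lintegral_comp_div Real.two_pi_pos (fun w => ‖𝓕 (dampedOrbit T ε h) w‖ₑ ^ 2),
    lintegral_enorm_fourier_sq hi hi2, ← mul_assoc, ← ENNReal.ofReal_mul hε.le]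
  congr 2
  ring

theorem IsC0Semigroup.resolventMean_idPMap_bounds (hT : IsC0Semigroup T)
    (hm : ∀ t : ℝ, 0 ≤ t → ∀ h, m * ‖h‖ ^ 2 ≤ ‖T t h‖ ^ 2)
    (hM : ∀ t : ℝ, 0 ≤ t → ∀ h, ‖T t h‖ ^ 2 ≤ M * ‖h‖ ^ 2) (hE : IsGeneratorOf E T) {ε : ℝ}
    (hε : 0 < ε) (h : H) :
    ENNReal.ofReal (Real.pi * m * ‖h‖ ^ 2) ≤ resolventMean (idPMap H) E h ε ∧
      resolventMean (idPMap H) E h ε ≤ ENNReal.ofReal (Real.pi * M * ‖h‖ ^ 2) := by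
  have e : ∀ c : ℝ, ENNReal.ofReal (Real.pi * c * ‖h‖ ^ 2)
      = ENNReal.ofReal (2 * ε * Real.pi) * ENNReal.ofReal (c * ‖h‖ ^ 2 / (2 * ε)) := fun c => by
    rw [← ENNReal.ofReal_mul (by positivity)]
    congr 1
    field_simp
  rw [hT.resolventMean_idPMap hM hE hε, e, e]
  exact ⟨mul_le_mul_right (le_lintegral_enorm_dampedOrbit_sq h (fun t ht => hm t ht h) hε) _,
    mul_le_mul_right (lintegral_enorm_dampedOrbit_sq_le h (fun t ht => hM t ht h) hε) _⟩

end ResolventMeansOfSemigroup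

/-! ### Two-sided bounds from similarity -/

section Similarity

variable {H : Type u} [NormedAddCommGroup H] [InnerProductSpace ℂ H] {T : ℝ → H →L[ℂ] H}

theorem IsSimilarToIsometricSemigroup.exists_bounds (h : IsSimilarToIsometricSemigroup T) :
    ∃ m M : ℝ, 0 < m ∧ 0 < M ∧ ∀ t : ℝ, 0 ≤ t → ∀ h,
      m * ‖h‖ ^ 2 ≤ ‖T t h‖ ^ 2 ∧ ‖T t h‖ ^ 2 ≤ M * ‖h‖ ^ 2 := by
  obtain ⟨S, R, -, hS, hRS⟩ := h
  -- Adding `1` keeps the constants positive even when `H` is trivial.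
  set a : ℝ := ‖(R : H →L[ℂ] H)‖ + 1
  set b : ℝ := ‖(R.symm : H →L[ℂ] H)‖ + 1
  have ha : 0 < a := by positivity
  have hb : 0 < b := by positivity
  have hRa : ∀ x, ‖R x‖ ≤ a * ‖x‖ := fun x => by
    have := (R : H →L[ℂ] H).le_opNorm x
    rw [ContinuousLinearEquiv.coe_coe] at this
    nlinarith [norm_nonneg x]
  have hRb : ∀ x, ‖x‖ ≤ b * ‖R x‖ := fun x => by
    have := (R.symm : H →L[ℂ] H).le_opNorm (R x)
    rw [ContinuousLinearEquiv.coe_coe, R.symm_apply_apply] at this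
    nlinarith [norm_nonneg (R x)]
  have hiso : ∀ t : ℝ, 0 ≤ t → ∀ x, ‖R (T t x)‖ = ‖R x‖ := fun t ht x => by
    have := hRS t ht (R x)
    rw [R.symm_apply_apply] at this
    rw [this, hS t ht]
  refine ⟨((a * b) ^ 2)⁻¹, (a * b) ^ 2, by positivity, by positivity, fun t ht x => ⟨?_, ?_⟩⟩
  · rw [inv_mul_le_iff₀ (by positivity), ← mul_pow]
    refine pow_le_pow_left₀ (norm_nonneg _) ?_ 2
    calc ‖x‖ ≤ b * ‖R x‖ := hRb x
      _ = b * ‖R (T t x)‖ := by rw [hiso t ht]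
      _ ≤ b * (a * ‖T t x‖) := mul_le_mul_of_nonneg_left (hRa _) hb.le
      _ = a * b * ‖T t x‖ := by ring
  · rw [← mul_pow]
    refine pow_le_pow_left₀ (norm_nonneg _) ?_ 2
    calc ‖T t x‖ ≤ b * ‖R (T t x)‖ := hRb _
      _ = b * ‖R x‖ := by rw [hiso t ht]
      _ ≤ b * (a * ‖x‖) := mul_le_mul_of_nonneg_left (hRa _) hb.le
      _ = a * b * ‖x‖ := by ring

end Similarity

/-! ### The equivalence -/

theorem mainTheorem12 {H : Type u} [NormedAddCommGroup H] [InnerProductSpace ℂ H]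
    [CompleteSpace H] (E : H →ₗ.[ℂ] H) :
    List.TFAE [
      -- `E` generates a `C₀`-semigroup similar to an isometric one
      ∃ T : ℝ → H →L[ℂ] H, IsC0Semigroup T ∧ IsGeneratorOf E T ∧
        IsSimilarToIsometricSemigroup T,
      -- `E` generates a `C₀`-semigroup with two-sided bounds on weighted Cesàro means
      ∃ T : ℝ → H →L[ℂ] H, IsC0Semigroup T ∧ IsGeneratorOf E T ∧
        ∃ (K : Type u) (_ : NormedAddCommGroup K) (_ : InnerProductSpace ℂ K)
          (_ : CompleteSpace K) (C : H →ₗ.[ℂ] K),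
          IsSemigroupWeight C T ∧
          ∃ α β : ℝ, 0 < α ∧ 0 < β ∧
            ((∀ h ∈ C.domain,
                ENNReal.ofReal (α * ‖h‖ ^ 2) ≤ limsup (cesaroMean C T h) atTop ∧
                limsup (cesaroMean C T h) atTop ≤ ENNReal.ofReal (β * ‖h‖ ^ 2)) ∨
             (∀ h ∈ C.domain,
                ENNReal.ofReal (α * ‖h‖ ^ 2) ≤ liminf (cesaroMean C T h) atTop ∧
                liminf (cesaroMean C T h) atTop ≤ ENNReal.ofReal (β * ‖h‖ ^ 2))),
      -- spectrum in the closed left half-plane and two-sided bounds on weighted resolvent means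
      operatorSpectrum E ⊆ {z : ℂ | z.re ≤ 0} ∧
        ∃ (K : Type u) (_ : NormedAddCommGroup K) (_ : InnerProductSpace ℂ K)
          (_ : CompleteSpace K) (C : H →ₗ.[ℂ] K),
          IsResolventWeight C E ∧
          ∃ α β : ℝ, 0 < α ∧ 0 < β ∧ ∀ h : H,
            limsup (resolventMean C E h) (𝓝[>] 0) ≤ ENNReal.ofReal (β * ‖h‖ ^ 2) ∧
            ENNReal.ofReal (α * ‖h‖ ^ 2) ≤ liminf (resolventMean C E h) (𝓝[>] 0)] := by
  tfae_have 1 → 2 := by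
    rintro ⟨T, hT, hE, hsim⟩
    obtain ⟨m, M, hm, hM, hb⟩ := hsim.exists_bounds
    refine ⟨T, hT, hE, H, inferInstance, inferInstance, inferInstance, idPMap H,
      hT.isSemigroupWeight_idPMap fun t ht h => norm_le_sqrt_mul (hb t ht h).2,
      m, M, hm, hM, Or.inl fun h _ => ⟨?_, ?_⟩⟩
    -- Any eventual upper bound `c` is tested at one positive time, where the mean already exceeds
    -- `m‖h‖²` weakly.
    · refine le_limsup_of_le (by isBoundedDefault) fun c hc => ?_
      obtain ⟨t, h1, h2⟩ := (hc.and (eventually_gt_atTop 0)).exists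
      exact (le_cesaroMean_idPMap h (fun s hs => (hb s hs h).1) h2).trans h1
    · refine limsup_le_of_le (by isBoundedDefault) ?_
      filter_upwards [eventually_gt_atTop 0] with t ht
      exact cesaroMean_idPMap_le h (fun s hs => (hb s hs h).2) ht
  tfae_have 2 → 1 := by
    rintro ⟨T, hT, hE, K, _, _, _, C, hC, α, β, hα, hβ, h⟩
    have hb : ∀ t : ℝ, 0 ≤ t → ∀ h, α / β * ‖h‖ ^ 2 ≤ ‖T t h‖ ^ 2 ∧
        ‖T t h‖ ^ 2 ≤ 2 * β / α * ‖h‖ ^ 2 := by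
      intro t ht x
      rcases h with h | h
      · exact hC.norm_sq_bounds_of_limsup hT hα hβ h ht x
      · exact hC.norm_sq_bounds_of_liminf hT hα hβ h ht x
    exact ⟨T, hT, hE, hT.isSimilarToIsometricSemigroup (div_pos hα hβ)
      (fun t ht x => (hb t ht x).1) fun t ht x => (hb t ht x).2⟩
  tfae_have 1 → 3 := by
    rintro ⟨T, hT, hE, hsim⟩
    obtain ⟨m, M, hm, hM, hb⟩ := hsim.exists_bounds
    have hM' : ∀ t : ℝ, 0 ≤ t → ∀ h, ‖T t h‖ ≤ √M * ‖h‖ := fun t ht h =>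
      norm_le_sqrt_mul (hb t ht h).2
    have hmean := fun (ε : ℝ) (hε : 0 < ε) (h : H) => hT.resolventMean_idPMap_bounds
      (fun t ht x => (hb t ht x).1) (fun t ht x => (hb t ht x).2) hE hε h
    refine ⟨fun z hz => ?_, H, inferInstance, inferInstance, inferInstance, idPMap H,
      hT.isResolventWeight_idPMap hM' hE, Real.pi * m, Real.pi * M,
      mul_pos Real.pi_pos hm, mul_pos Real.pi_pos hM, fun h => ⟨?_, ?_⟩⟩
    · by_contra hz'
      exact hz (hT.operatorResolvent_apply hM' hE (not_le.1 hz')).1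
    · refine limsup_le_of_le (by isBoundedDefault) ?_
      filter_upwards [self_mem_nhdsWithin] with ε hε
      exact (hmean ε hε h).2
    · refine le_liminf_of_le (by isBoundedDefault) ?_
      filter_upwards [self_mem_nhdsWithin] with ε hε
      exact (hmean ε hε h).1
  tfae_have 3 → 1 := by
    rintro ⟨hσ, K, _, _, _, C, hC, α, β, hα, hβ, hmean⟩
    have hρ : ∀ z : ℂ, 0 < z.re → z ∈ operatorResolventSet E := fun z hz => by
      by_contra hz'
      exact absurd (hσ hz') (not_le.2 hz)
    obtain ⟨T, hT, hE, m, M, hm, hb⟩ := hC.exists_isC0Semigroup hρ hα hβ hmean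
    exact ⟨T, hT, hE, hT.isSimilarToIsometricSemigroup hm (fun t ht x => (hb t ht x).1)
      fun t ht x => (hb t ht x).2⟩
  tfae_finish
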